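/- Let $\mathcal H\neq 0$ be a finite-dimensional complex Hilbert space, and let $\mathsf D(\mathcal K)$ denote the set of density operators on $\mathcal K$. A quantum channel is a completely positive trace-preserving linear map. For channels $\mathcal E,\mathcal F$ on $\mathcal H$ with (finite) Kraus families $\{E_i\},\{F_j\}$ and a state $\omega\in\mathsf D(\mathbb C^2)$ of a control qubit, the switched channel is $$\mathcal S_\omega(\mathcal E,\mathcal F)(\rho)=\sum_{i,j}K_{ij}(\rho\otimes\omega)K_{ij}^\dagger,\qquad K_{ij}=E_iF_j\otimes|0\rangle\langle 0|+F_jE_i\otimes|1\rangle\langle 1| .$$ It maps states on $\mathcal H$ to states on $\mathcal H\otimes\mathbb C^2$, and it does not depend on the choice of the Kraus families. (1) If $\mathcal E_0$ and $\mathcal F_0$ are complete erasure channels on $\mathcal H$ (each maps all input states to one fixed state), then for every $\omega\in\mathsf D(\mathbb C^2)$ the channel $\mathcal S_\omega(\mathcal E_0,\mathcal F_0)$ is entanglement-breaking: for every finite-dimensional ancilla and every joint state $\rho$ of ancilla and input, $(\mathcal I\otimes\mathcal S_\omega(\mathcal E_0,\mathcal F_0))(\rho)$ is separable, i.e. a finite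 convex combination of product states. (2) Consequently, if $\mathcal E$ and $\mathcal F$ are channels on $\mathcal H$ with zero classical capacity, then $Q(\mathcal S_\omega(\mathcal E,\mathcal F))=0$ for every $\omega\in\mathsf D(\mathbb C^2)$; in particular this holds for $\mathcal F=\mathcal E$. Here, with $S(\rho)=-\operatorname{Tr}[\rho\log_2\rho]$, the classical capacity is $C(\mathcal E)=\lim_{n}\chi(\mathcal E^{\otimes n})/n$, where $\chi(\mathcal N)=\sup\big[S(\sum_x p_x\mathcal N(\rho_x))-\sum_x p_xS(\mathcal N(\rho_x))\big]$ over all finite ensembles $(p_x,\rho_x)$ of input states; and the quantum capacity is $Q(\mathcal E)=\lim_n I_{\rm c}(\mathcal E^{\otimes n})/n$, where, for a channel $\mathcal N$ with input space $\mathcal H_A$ and output $B$, $I_{\rm c}(\mathcal N)=\sup_{\rho\in\mathsf D(\mathcal H_A\otimes\mathcal H_A)}[S(\sigma_B)-S(\sigma)]$ with $\sigma=(\mathcal I\otimes\mathcal N)(\rho)$ and $\sigma_B$ its marginal on the output of $\mathcal N$. -/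

import Mathlib

open scoped ComplexOrder Kronecker
open Filter Topology

namespace QSwitch

noncomputable section

/-- A density operator: positive semidefinite with unit trace. -/
def IsDensity {ι : Type*} [Fintype ι] (ρ : Matrix ι ι ℂ) : Prop :=
  ρ.PosSemidef ∧ ρ.trace = 1

/-- The map `id ⊗ Φ`, acting on operators on (ancilla) ⊗ (input): it applies `Φ` to every block. -/
def idTensor {ι κ : Type*} (α : Type*)
    (Φ : Matrix ι ι ℂ →ₗ[ℂ] Matrix κ κ ℂ) (X : Matrix (α × ι) (α × ι) ℂ) :
    Matrix (α × κ) (α × κ) ℂ :=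
  Matrix.of fun r s => Φ (Matrix.of fun i j => X (r.1, i) (s.1, j)) r.2 s.2

/-- Complete positivity: `id ⊗ Φ` is positive for every finite-dimensional ancilla. -/
def IsCompletelyPositive {ι κ : Type*}
    (Φ : Matrix ι ι ℂ →ₗ[ℂ] Matrix κ κ ℂ) : Prop :=
  ∀ (n : ℕ) (X : Matrix (Fin n × ι) (Fin n × ι) ℂ),
    X.PosSemidef → (idTensor (Fin n) Φ X).PosSemidef

/-- A quantum channel: a completely positive, trace-preserving linear map. -/
def IsChannel {ι κ : Type*} [Fintype ι] [Fintype κ]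
    (Φ : Matrix ι ι ℂ →ₗ[ℂ] Matrix κ κ ℂ) : Prop :=
  IsCompletelyPositive Φ ∧ ∀ X, (Φ X).trace = X.trace

/-- `K` is a family of Kraus operators of `Φ`. For a trace-preserving `Φ`, the normalization
`∑ i, (K i)ᴴ * K i = 1` follows. -/
def IsKraus {ι κ ν : Type*} [Fintype ι] [Fintype ν]
    (Φ : Matrix ι ι ℂ →ₗ[ℂ] Matrix κ κ ℂ) (K : ν → Matrix κ ι ℂ) : Prop :=
  ∀ X, Φ X = ∑ i, K i * X * (K i).conjTranspose

open scoped MatrixOrder Matrix.Norms.L2Operator in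
/-- Every completely positive map has a finite family of Kraus operators. -/
theorem exists_isKraus {ι κ : Type*} [Fintype ι] [DecidableEq ι] [Fintype κ] [DecidableEq κ]
    (Φ : Matrix ι ι ℂ →ₗ[ℂ] Matrix κ κ ℂ) (hΦ : IsCompletelyPositive Φ) :
    ∃ (m : ℕ) (K : Fin m → Matrix κ ι ℂ), IsKraus Φ K := by
  let e := Fintype.equivFin ι
  let v : Matrix (Fin (Fintype.card ι) × ι) Unit ℂ :=
    Matrix.of fun r _ => if r.1 = e r.2 then 1 else 0
  have h := hΦ _ _ (Matrix.posSemidef_self_mul_conjTranspose v)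
  obtain ⟨B, hB⟩ := CStarAlgebra.nonneg_iff_eq_star_mul_self.mp h.nonneg
  rw [Matrix.star_eq_conjTranspose] at hB
  have key : ∀ (i j : ι) (x y : κ), Φ (Matrix.single i j 1) x y
      = ∑ k, star (B k (e i, x)) * B k (e j, y) := by
    intro i j x y
    have h1 := congrFun (congrFun hB (e i, x)) (e j, y)
    simp only [Matrix.mul_apply, Matrix.conjTranspose_apply] at h1
    rw [← h1]
    simp only [idTensor, Matrix.of_apply]
    refine congrFun (congrFun (congrArg Φ ?_) x) y
    ext a b
    by_cases h1 : i = a <;> by_cases h2 : j = b <;>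
      simp [v, Matrix.mul_apply, h1, h2]
  let f := Fintype.equivFin (Fin (Fintype.card ι) × κ)
  refine ⟨_, fun k => Matrix.of fun x i => star (B (f.symm k) (e i, x)), ?_⟩
  intro X
  ext x y
  conv_lhs => rw [Matrix.matrix_eq_sum_single X]
  rw [Fintype.sum_equiv f.symm _
    (fun k => (Matrix.of fun x i => star (B k (e i, x))) * X *
      (Matrix.of fun x i => star (B k (e i, x))).conjTranspose) (fun _ => rfl)]
  have hs : ∀ i j, Matrix.single i j (X i j) = X i j • Matrix.single i j (1 : ℂ) := by
    intro i j; simp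
  simp only [map_sum, hs, map_smul, Matrix.sum_apply, Matrix.smul_apply, key, Matrix.mul_apply,
    Matrix.of_apply, Matrix.conjTranspose_apply, star_star, smul_eq_mul, Finset.mul_sum,
    Finset.sum_mul]
  rw [Finset.sum_comm]
  conv_rhs => rw [Finset.sum_comm]
  refine Finset.sum_congr rfl fun j _ => ?_
  rw [Finset.sum_comm]
  refine Finset.sum_congr rfl fun k _ => Finset.sum_congr rfl fun i _ => ?_
  ring

/-- A complete erasure channel maps every input state to one fixed output state. -/
def IsCompleteErasure {ι κ : Type*} [Fintype ι] [Fintype κ]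
    (Φ : Matrix ι ι ℂ →ₗ[ℂ] Matrix κ κ ℂ) : Prop :=
  IsChannel Φ ∧ ∃ ρ₀, IsDensity ρ₀ ∧ ∀ ρ, IsDensity ρ → Φ ρ = ρ₀

/-- Separable states: finite convex combinations of product states. -/
def IsSeparable {α β : Type*} [Fintype α] [Fintype β]
    (σ : Matrix (α × β) (α × β) ℂ) : Prop :=
  ∃ (m : ℕ) (q : Fin m → ℝ) (a : Fin m → Matrix α α ℂ) (b : Fin m → Matrix β β ℂ),
    (∀ i, 0 ≤ q i) ∧ ∑ i, q i = 1 ∧ (∀ i, IsDensity (a i)) ∧ (∀ i, IsDensity (b i)) ∧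
    σ = ∑ i, (q i : ℂ) • (a i ⊗ₖ b i)

/-- An entanglement-breaking channel: a channel `Φ` such that `id ⊗ Φ` maps every joint state of
any finite-dimensional ancilla and the input into a separable state. -/
def IsEntanglementBreaking {ι κ : Type*} [Fintype ι] [Fintype κ]
    (Φ : Matrix ι ι ℂ →ₗ[ℂ] Matrix κ κ ℂ) : Prop :=
  IsChannel Φ ∧ ∀ (n : ℕ) (ρ : Matrix (Fin n × ι) (Fin n × ι) ℂ),
    IsDensity ρ → IsSeparable (idTensor (Fin n) Φ ρ)

/-- The Kraus operators `E_i F_j ⊗ |0⟩⟨0| + F_j E_i ⊗ |1⟩⟨1|` of the quantum SWITCH; the second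
tensor factor is the control qubit. -/
def switchKraus {ι ν μ : Type*} [Fintype ι] (E : ν → Matrix ι ι ℂ) (F : μ → Matrix ι ι ℂ)
    (i : ν) (j : μ) : Matrix (ι × Fin 2) (ι × Fin 2) ℂ :=
  (E i * F j) ⊗ₖ Matrix.single 0 0 1 + (F j * E i) ⊗ₖ Matrix.single 1 1 1

/-- The switched channel with control state `ω`, for channels given by Kraus families `E`, `F`:
`ρ ↦ ∑ i j, K_ij (ρ ⊗ ω) K_ijᴴ`. -/
def switchedChannel {ι ν μ : Type*} [Fintype ι] [Fintype ν] [Fintype μ]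
    (E : ν → Matrix ι ι ℂ) (F : μ → Matrix ι ι ℂ) (ω : Matrix (Fin 2) (Fin 2) ℂ) :
    Matrix ι ι ℂ →ₗ[ℂ] Matrix (ι × Fin 2) (ι × Fin 2) ℂ where
  toFun ρ := ∑ i, ∑ j, switchKraus E F i j * (ρ ⊗ₖ ω) * (switchKraus E F i j).conjTranspose
  map_add' ρ σ := by
    simp only [Matrix.add_kronecker, Matrix.mul_add, Matrix.add_mul, Finset.sum_add_distrib]
  map_smul' c ρ := by
    simp only [Matrix.smul_kronecker, Matrix.mul_smul, Matrix.smul_mul, Finset.smul_sum,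
      RingHom.id_apply]

/-- The `n`-fold parallel use `Φ ⊗ ⋯ ⊗ Φ`, a map on operators on the `n`-fold tensor power,
whose product basis is indexed by `Fin n → ι`. -/
def tensorPower {ι κ : Type*} [Fintype ι] [DecidableEq ι]
    (Φ : Matrix ι ι ℂ →ₗ[ℂ] Matrix κ κ ℂ) (n : ℕ) :
    Matrix (Fin n → ι) (Fin n → ι) ℂ →ₗ[ℂ] Matrix (Fin n → κ) (Fin n → κ) ℂ where
  toFun X := Matrix.of fun x y =>
    ∑ p, ∑ q, X p q * ∏ k, Φ (Matrix.single (p k) (q k) 1) (x k) (y k)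
  map_add' X Y := by
    ext x y
    simp [add_mul, Finset.sum_add_distrib]
  map_smul' c X := by
    ext x y
    simp [Finset.mul_sum, mul_assoc]

/-- The von Neumann entropy `-Tr[ρ log₂ ρ]`, with `log₂ ρ` given by the functional calculus of
Hermitian matrices (and the convention `0 log₂ 0 = 0`). -/
def entropy {ι : Type*} [Fintype ι] [DecidableEq ι] (ρ : Matrix ι ι ℂ) : ℝ :=
  -(ρ * cfc (Real.logb 2) ρ).trace.re

/-- The Holevo quantity: the supremum over finite input ensembles `(p_x, ρ_x)` of
`S(∑ p_x Φ(ρ_x)) - ∑ p_x S(Φ(ρ_x))`. -/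
def holevo {ι κ : Type*} [Fintype ι] [Fintype κ] [DecidableEq κ]
    (Φ : Matrix ι ι ℂ →ₗ[ℂ] Matrix κ κ ℂ) : ℝ :=
  sSup {h : ℝ | ∃ (m : ℕ) (p : Fin m → ℝ) (ρ : Fin m → Matrix ι ι ℂ),
    (∀ x, 0 ≤ p x) ∧ ∑ x, p x = 1 ∧ (∀ x, IsDensity (ρ x)) ∧
    h = entropy (∑ x, (p x : ℂ) • Φ (ρ x)) - ∑ x, p x * entropy (Φ (ρ x))}

/-- The classical capacity of `Φ` is `c`: `holevo (Φ^{⊗ n}) / n → c`. -/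
def HasClassicalCapacity {ι κ : Type*} [Fintype ι] [DecidableEq ι] [Fintype κ] [DecidableEq κ]
    (Φ : Matrix ι ι ℂ →ₗ[ℂ] Matrix κ κ ℂ) (c : ℝ) : Prop :=
  Tendsto (fun n : ℕ => holevo (tensorPower Φ n) / n) atTop (𝓝 c)

/-- The partial trace over the first tensor factor. -/
def traceFst {α β : Type*} [Fintype α] (σ : Matrix (α × β) (α × β) ℂ) : Matrix β β ℂ :=
  Matrix.of fun x y => ∑ a, σ (a, x) (a, y)

/-- The coherent information of a bipartite state: `S(σ_B) - S(σ_AB)`. -/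
def stateCoherentInfo {α β : Type*} [Fintype α] [DecidableEq α] [Fintype β] [DecidableEq β]
    (σ : Matrix (α × β) (α × β) ℂ) : ℝ :=
  entropy (traceFst σ) - entropy σ

/-- The coherent information of a channel: the supremum of the coherent information of
`(id ⊗ Φ)(ρ)` over the joint states `ρ` of the input and a copy of the input. -/
def coherentInfo {ι κ : Type*} [Fintype ι] [DecidableEq ι] [Fintype κ] [DecidableEq κ]
    (Φ : Matrix ι ι ℂ →ₗ[ℂ] Matrix κ κ ℂ) : ℝ :=
  sSup {h : ℝ | ∃ ρ : Matrix (ι × ι) (ι × ι) ℂ,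
    IsDensity ρ ∧ h = stateCoherentInfo (idTensor ι Φ ρ)}

/-- The quantum capacity of `Φ` is `q`: `coherentInfo (Φ^{⊗ n}) / n → q`. -/
def HasQuantumCapacity {ι κ : Type*} [Fintype ι] [DecidableEq ι] [Fintype κ] [DecidableEq κ]
    (Φ : Matrix ι ι ℂ →ₗ[ℂ] Matrix κ κ ℂ) (q : ℝ) : Prop :=
  Tendsto (fun n : ℕ => coherentInfo (tensorPower Φ n) / n) atTop (𝓝 q)

end

end QSwitch

/-! Both claims follow from one fact: the switch of two complete erasures measures a POVM and
prepares a state. Let the erasures output `e = ∑ a_m |u_m⟩⟨u_m|` and `f = ∑ b_n |v_n⟩⟨v_n|`. The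
blocks of the switched output on `X` are `ω₀₀ tr(X) e`, `ω₁₁ tr(X) f`, `ω₀₁ e X f` and `ω₁₀ f X e`;
the off-diagonal ones come from `sum_sum_kraus_interchange`. Expanded in the two eigenbases, the
only nonclassical dependence on `X` is through `⟨u_m|X|v_n⟩ = tr(|v_n⟩⟨u_m| X)` and its reversed
counterpart. The operator `|v_n⟩⟨u_m|` is the average of two unitaries, and the spectral theorem
turns each unitary into a sum `∑ z_k M_k` of unit phases over a POVM
(`hasPhaseDecomposition_single`). Thus the output is `∑ a_m b_n tr(M_k X) τ_mnk`, where `τ_mnk` is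
the image of `ω` under the isometry `|0⟩ ↦ u_m|0⟩`, `|1⟩ ↦ z̄_k v_n|1⟩`.

For the capacities, product ensembles give `n` times any one-shot Holevo value as a lower bound for
`n` uses, so zero classical capacity leaves no gap in the concavity of the entropy. The quantitative
bound `entropy_midpoint_gap` then makes the channel constant on states. Measure-and-prepare channels
are stable under tensor powers and have separable outputs, for which `S(σ_B) ≤ S(σ)`
(`IsSeparable.entropy_traceFst_le`); hence all coherent informations vanish. -/

namespace QSwitch

set_option linter.unusedSectionVars false

/-! ### Spectral sums and strong concavity of the entropy. -/

section Spectral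

open Matrix

variable {m n : Type*} [Fintype m] [DecidableEq m] [Fintype n] [DecidableEq n]

/-- The sum of `f` over the spectrum, counted with multiplicity. -/
noncomputable def specSum (f : ℝ → ℝ) (A : Matrix n n ℂ) : ℝ :=
  (A.charpoly.roots.map fun z => f z.re).sum

theorem specSum_eq_sum_eigenvalues (f : ℝ → ℝ) {A : Matrix n n ℂ} (hA : A.IsHermitian) :
    specSum f A = ∑ i, f (hA.eigenvalues i) := by
  rw [specSum, hA.roots_charpoly_eq_eigenvalues]
  simp

theorem specSum_diagonal (f : ℝ → ℝ) (d : n → ℂ) :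
    specSum f (diagonal d) = ∑ i, f (d i).re := by
  rw [specSum, charpoly_diagonal, Polynomial.roots_prod _ _
    (Finset.prod_ne_zero_iff.mpr fun i _ => Polynomial.X_sub_C_ne_zero _)]
  simp

/-- The characteristic polynomials agree up to powers of `X`, and the extra zero roots contribute `f
0 = 0`. This compares the entropies of matrices of different sizes. -/
theorem specSum_mul_comm {f : ℝ → ℝ} (hf : f 0 = 0) (A : Matrix m n ℂ) (B : Matrix n m ℂ) :
    specSum f (A * B) = specSum f (B * A) := by
  have key := congrArg (fun p => (p.roots.map fun z : ℂ => f z.re).sum)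
    (charpoly_mul_comm' A B)
  have hne : ∀ (k : ℕ), (Polynomial.X ^ k : Polynomial ℂ) ≠ 0 := fun k =>
    pow_ne_zero _ Polynomial.X_ne_zero
  rw [Polynomial.roots_mul (mul_ne_zero (hne _) (charpoly_monic _).ne_zero),
    Polynomial.roots_mul (mul_ne_zero (hne _) (charpoly_monic _).ne_zero)] at key
  simpa [specSum, hf, Multiset.map_nsmul, Multiset.sum_nsmul] using key

theorem specSum_conj {U : Matrix n n ℂ} (hU : Uᴴ * U = 1) (f : ℝ → ℝ) (A : Matrix n n ℂ) :
    specSum f (U * A * Uᴴ) = specSum f A := by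
  rw [specSum, charpoly_mul_comm, ← Matrix.mul_assoc, hU, Matrix.one_mul, specSum]

theorem exists_diagonalization {A : Matrix n n ℂ} (hA : A.IsHermitian) :
    ∃ U : Matrix n n ℂ, Uᴴ * U = 1 ∧ U * Uᴴ = 1 ∧
      A = U * diagonal (fun i => (hA.eigenvalues i : ℂ)) * Uᴴ := by
  refine ⟨hA.eigenvectorUnitary, ?_, ?_, ?_⟩
  · exact (mem_unitaryGroup_iff').mp hA.eigenvectorUnitary.2
  · exact (mem_unitaryGroup_iff).mp hA.eigenvectorUnitary.2
  · conv_lhs => rw [hA.spectral_theorem]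
    rfl

theorem trace_mul_cfc (f : ℝ → ℝ) {A : Matrix n n ℂ} (hA : A.IsHermitian) :
    (A * cfc f A).trace.re = specSum (fun x => x * f x) A := by
  rw [specSum_eq_sum_eigenvalues _ hA, hA.cfc_eq, IsHermitian.cfc]
  conv_lhs => enter [1, 1, 1]; rw [hA.spectral_theorem]
  rw [← map_mul, Unitary.conjStarAlgAut_apply, trace_mul_cycle, Unitary.coe_star_mul_self,
    Matrix.one_mul, diagonal_mul_diagonal, trace_diagonal]
  simp [Function.comp_def]

theorem entropy_eq_specSum {A : Matrix n n ℂ} (hA : A.IsHermitian) :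
    entropy A = specSum Real.negMulLog A / Real.log 2 := by
  rw [entropy, trace_mul_cfc _ hA, specSum_eq_sum_eigenvalues _ hA,
    specSum_eq_sum_eigenvalues _ hA, Finset.sum_div, ← Finset.sum_neg_distrib]
  refine Finset.sum_congr rfl fun i _ => ?_
  simp only [Real.logb, Real.negMulLog]
  ring

theorem specSum_id {A : Matrix n n ℂ} (hA : A.IsHermitian) : specSum id A = A.trace.re := by
  rw [specSum_eq_sum_eigenvalues _ hA, hA.trace_eq_sum_eigenvalues]
  simp

theorem specSum_sq {A : Matrix n n ℂ} (hA : A.IsHermitian) :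
    specSum (fun x => x * x) A = (A * A).trace.re := by
  have h := trace_mul_cfc id hA
  have hid : cfc (id : ℝ → ℝ) A = A := cfc_id' ℝ A hA
  rw [hid] at h
  exact h.symm

theorem IsDensity.sum_eigenvalues {A : Matrix n n ℂ} (hA : IsDensity A) :
    ∑ i, hA.1.1.eigenvalues i = 1 := by
  have := specSum_id hA.1.1
  rw [specSum_eq_sum_eigenvalues _ hA.1.1] at this
  exact this.trans (by simp [hA.2])

theorem IsDensity.eigenvalues_mem_Icc {A : Matrix n n ℂ} (hA : IsDensity A) (i : n) :
    hA.1.1.eigenvalues i ∈ Set.Icc (0 : ℝ) 1 := by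
  refine ⟨hA.1.eigenvalues_nonneg i, ?_⟩
  rw [← IsDensity.sum_eigenvalues hA]
  exact Finset.single_le_sum (fun j _ => hA.1.eigenvalues_nonneg j) (Finset.mem_univ i)

theorem IsDensity.entropy_nonneg {A : Matrix n n ℂ} (hA : IsDensity A) : 0 ≤ entropy A := by
  rw [entropy_eq_specSum hA.1.1, specSum_eq_sum_eigenvalues _ hA.1.1]
  refine div_nonneg (Finset.sum_nonneg fun i _ => ?_) (Real.log_nonneg one_le_two)
  exact Real.negMulLog_nonneg (hA.eigenvalues_mem_Icc i).1 (hA.eigenvalues_mem_Icc i).2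

/-- A crude bound from `-x log x ≤ 1 - x ≤ 1`; it serves only to bound the Holevo set from above. -/
theorem IsDensity.entropy_le {A : Matrix n n ℂ} (hA : IsDensity A) :
    entropy A ≤ Fintype.card n / Real.log 2 := by
  rw [entropy_eq_specSum hA.1.1, specSum_eq_sum_eigenvalues _ hA.1.1]
  refine div_le_div_of_nonneg_right ?_ (Real.log_nonneg one_le_two)
  calc ∑ i, Real.negMulLog (hA.1.1.eigenvalues i) ≤ ∑ _i : n, (1 : ℝ) := by
        refine Finset.sum_le_sum fun i _ => ?_
        have h := (hA.eigenvalues_mem_Icc i).1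
        linarith [Real.negMulLog_le_one_sub_self h]
    _ = Fintype.card n := by simp

/-- Jensen's inequality for the diagonal of the image of `A` under a bistochastic map. -/
theorem specSum_le_sum_diag {ν : Type*} [Fintype ν] {f : ℝ → ℝ} {s : Set ℝ}
    (hf : ConcaveOn ℝ s f) {A : Matrix n n ℂ} (hA : A.IsHermitian)
    (hs : ∀ i, hA.eigenvalues i ∈ s) (K : ν → Matrix m n ℂ)
    (h₁ : ∑ a, K a * (K a)ᴴ = 1) (h₂ : ∑ a, (K a)ᴴ * K a = 1) :
    (∀ j, ((∑ a, K a * A * (K a)ᴴ) j j).re ∈ s) ∧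
      specSum f A ≤ ∑ j, f ((∑ a, K a * A * (K a)ᴴ) j j).re := by
  obtain ⟨U, hU₁, hU₂, hUA⟩ := exists_diagonalization hA
  rw [specSum_eq_sum_eigenvalues _ hA]
  set μ := hA.eigenvalues
  -- The diagonal of the image is `D` applied to the eigenvalues. Rows of `D` sum to one by `h₁`,
  -- which permits Jensen; columns do by `h₂`, which recovers the full spectral sum.
  let D : m → n → ℝ := fun j k => ∑ a, Complex.normSq ((K a * U) j k)
  have hD₀ : ∀ j k, 0 ≤ D j k := fun j k => Finset.sum_nonneg fun a _ => Complex.normSq_nonneg _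
  have hrow : ∀ j, ∑ k, D j k = 1 := by
    intro j
    have h := congrFun (congrFun (show ∑ a, (K a * U) * (K a * U)ᴴ = 1 by
      rw [← h₁]; refine Finset.sum_congr rfl fun a _ => ?_
      rw [conjTranspose_mul, Matrix.mul_assoc, ← Matrix.mul_assoc U, hU₂, Matrix.one_mul]) j) j
    simp only [Matrix.sum_apply, mul_apply (M := K _ * U), conjTranspose_apply, one_apply_eq] at h
    have h' : ((∑ k, D j k : ℝ) : ℂ) = 1 := by
      rw [← h, Finset.sum_comm]
      simp [Complex.normSq_eq_conj_mul_self, mul_comm]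
    exact_mod_cast h'
  have hcol : ∀ k, ∑ j, D j k = 1 := by
    intro k
    have h := congrFun (congrFun (show ∑ a, (K a * U)ᴴ * (K a * U) = 1 by
      rw [← hU₁, ← Matrix.mul_one Uᴴ, ← h₂, Matrix.mul_sum, Matrix.sum_mul]
      refine Finset.sum_congr rfl fun a _ => ?_
      rw [conjTranspose_mul]; simp only [Matrix.mul_assoc]) k) k
    simp only [Matrix.sum_apply, mul_apply (M := (K _ * U)ᴴ), conjTranspose_apply, one_apply_eq] at h
    have h' : ((∑ j, D j k : ℝ) : ℂ) = 1 := by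
      rw [← h, Finset.sum_comm]
      simp [Complex.normSq_eq_conj_mul_self]
    exact_mod_cast h'
  have hdiag : ∀ j, ((∑ a, K a * A * (K a)ᴴ) j j).re = ∑ k, D j k • μ k := by
    intro j
    have h' : (∑ a, K a * A * (K a)ᴴ) j j = ((∑ k, D j k * μ k : ℝ) : ℂ) := by
      have : ∀ a, K a * A * (K a)ᴴ
          = (K a * U) * diagonal (fun i => (μ i : ℂ)) * (K a * U)ᴴ := fun a => by
        conv_lhs => rw [hUA]
        rw [conjTranspose_mul]; simp only [Matrix.mul_assoc]
      simp only [this, Matrix.sum_apply, mul_apply (M := _ * diagonal _), mul_diagonal,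
        conjTranspose_apply]
      rw [Finset.sum_comm]
      simp [D, Complex.normSq_eq_conj_mul_self, Finset.sum_mul]
      refine Finset.sum_congr rfl fun a _ => Finset.sum_congr rfl fun b _ => ?_
      ring
    rw [h']; simp
  have hmem : ∀ j, ∑ k, D j k • μ k ∈ s := fun j =>
    hf.1.sum_mem (fun k _ => hD₀ j k) (hrow j) (fun k _ => hs k)
  refine ⟨fun j => hdiag j ▸ hmem j, ?_⟩
  calc ∑ k, f (μ k) = ∑ k, ∑ j, D j k • f (μ k) := by
        refine Finset.sum_congr rfl fun k _ => ?_
        rw [← Finset.sum_smul, hcol, one_smul]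
    _ = ∑ j, ∑ k, D j k • f (μ k) := Finset.sum_comm
    _ ≤ ∑ j, f (∑ k, D j k • μ k) := Finset.sum_le_sum fun j _ =>
        hf.le_map_sum (fun k _ => hD₀ j k) (hrow j) (fun k _ => hs k)
    _ = _ := by simp only [hdiag]

/-- If `V` diagonalizes the image, the operators `Vᴴ * K a` satisfy the same two normalizations and
give a diagonal output, whose diagonal is the spectrum of the image. -/
theorem specSum_le_of_bistochastic {ν : Type*} [Fintype ν] {f : ℝ → ℝ} {s : Set ℝ}
    (hf : ConcaveOn ℝ s f) {A : Matrix n n ℂ} (hA : A.IsHermitian)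
    (hs : ∀ i, hA.eigenvalues i ∈ s) (K : ν → Matrix m n ℂ)
    (h₁ : ∑ a, K a * (K a)ᴴ = 1) (h₂ : ∑ a, (K a)ᴴ * K a = 1) :
    specSum f A ≤ specSum f (∑ a, K a * A * (K a)ᴴ) := by
  have hB : (∑ a, K a * A * (K a)ᴴ).IsHermitian := by
    simp only [IsHermitian, conjTranspose_sum, conjTranspose_mul, conjTranspose_conjTranspose,
      hA.eq, Matrix.mul_assoc]
  obtain ⟨V, hV₁, hV₂, hVB⟩ := exists_diagonalization hB
  have h := (specSum_le_sum_diag hf hA hs (fun a => Vᴴ * K a) (by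
    rw [← hV₁]; conv_rhs => rw [← Matrix.mul_one Vᴴ, ← h₁, Matrix.mul_sum, Matrix.sum_mul]
    simp only [conjTranspose_mul, conjTranspose_conjTranspose, Matrix.mul_assoc]) (by
    rw [← h₂]
    refine Finset.sum_congr rfl fun a _ => ?_
    rw [conjTranspose_mul, conjTranspose_conjTranspose, Matrix.mul_assoc, ← Matrix.mul_assoc V, hV₂,
      Matrix.one_mul])).2
  have hd : ∑ a, Vᴴ * K a * A * (Vᴴ * K a)ᴴ = diagonal (fun i => (hB.eigenvalues i : ℂ)) := by
    have : ∑ a, Vᴴ * K a * A * (Vᴴ * K a)ᴴ = Vᴴ * (∑ a, K a * A * (K a)ᴴ) * V := by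
      rw [Matrix.mul_sum, Matrix.sum_mul]
      simp only [conjTranspose_mul, conjTranspose_conjTranspose, Matrix.mul_assoc]
    rw [this]
    nth_rw 1 [hVB]
    simp only [← Matrix.mul_assoc, hV₁, Matrix.one_mul]
    rw [Matrix.mul_assoc, hV₁, Matrix.mul_one]
  rw [hd] at h
  rw [specSum_eq_sum_eigenvalues f hB]
  simpa using h

/-- In an eigenbasis of the midpoint its eigenvalues are averages of the diagonal entries of `A` and
`B`. Scalar concavity applies there, and passing from a spectrum to a diagonal does not decrease the
sum. -/
theorem specSum_midpoint {f : ℝ → ℝ} {s : Set ℝ}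
    (hf : ConcaveOn ℝ s f) {A B : Matrix n n ℂ} (hA : A.IsHermitian) (hB : B.IsHermitian)
    (hsA : ∀ i, hA.eigenvalues i ∈ s) (hsB : ∀ i, hB.eigenvalues i ∈ s) :
    (specSum f A + specSum f B) / 2 ≤ specSum f ((1 / 2 : ℂ) • A + (1 / 2 : ℂ) • B) := by
  have hC : ((1 / 2 : ℂ) • A + (1 / 2 : ℂ) • B).IsHermitian := by
    simp [IsHermitian, hA.eq, hB.eq]
  obtain ⟨V, hV₁, hV₂, hVC⟩ := exists_diagonalization hC
  have hK₁ : ∑ _a : Unit, Vᴴ * Vᴴᴴ = 1 := by simpa using hV₁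
  have hK₂ : ∑ _a : Unit, Vᴴᴴ * Vᴴ = 1 := by simpa using hV₂
  obtain ⟨ha, hA'⟩ := specSum_le_sum_diag hf hA hsA (fun _ : Unit => Vᴴ) hK₁ hK₂
  obtain ⟨hb, hB'⟩ := specSum_le_sum_diag hf hB hsB (fun _ : Unit => Vᴴ) hK₁ hK₂
  simp only [Finset.univ_unique, Finset.sum_singleton, conjTranspose_conjTranspose] at ha hA' hb hB'
  have hd : ∀ i, hC.eigenvalues i
      = (1 / 2 : ℝ) • ((Vᴴ * A * V) i i).re + (1 / 2 : ℝ) • ((Vᴴ * B * V) i i).re := by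
    intro i
    have h : Vᴴ * ((1 / 2 : ℂ) • A + (1 / 2 : ℂ) • B) * V
        = diagonal (fun i => (hC.eigenvalues i : ℂ)) := by
      nth_rw 1 [hVC]
      simp only [← Matrix.mul_assoc, hV₁, Matrix.one_mul]
      rw [Matrix.mul_assoc, hV₁, Matrix.mul_one]
    have h' := congrArg Complex.re (congrFun (congrFun h i) i)
    simp only [diagonal_apply_eq, Complex.ofReal_re] at h'
    rw [← h', Matrix.mul_add, Matrix.add_mul, Matrix.add_apply, Matrix.mul_smul, Matrix.mul_smul,
      Matrix.smul_mul, Matrix.smul_mul, Matrix.smul_apply, Matrix.smul_apply]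
    simp
  rw [specSum_eq_sum_eigenvalues f hC]
  calc _ ≤ ∑ i, ((1 / 2 : ℝ) • f ((Vᴴ * A * V) i i).re
        + (1 / 2 : ℝ) • f ((Vᴴ * B * V) i i).re) := by
        simp only [smul_eq_mul, Finset.sum_add_distrib, ← Finset.mul_sum]
        linarith
    _ ≤ _ := Finset.sum_le_sum fun i _ => by
        rw [hd i]
        exact hf.2 (ha i) (hb i) (by norm_num) (by norm_num) (by norm_num)

/-- `-x log x + x² / 2` is concave on `[0, 1]`. -/
theorem concaveOn_negMulLog_add_sq :
    ConcaveOn ℝ (Set.Icc 0 1) fun x : ℝ => Real.negMulLog x + x * x / 2 := by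
  have hder : ∀ x ∈ interior (Set.Icc (0 : ℝ) 1),
      HasDerivAt (fun x : ℝ => Real.negMulLog x + x * x / 2) (-Real.log x - 1 + x) x := by
    intro x hx
    rw [interior_Icc] at hx
    have := (Real.hasDerivAt_negMulLog hx.1.ne').add
      (((hasDerivAt_id x).mul (hasDerivAt_id x)).div_const 2)
    refine this.congr_deriv ?_
    simp
  refine AntitoneOn.concaveOn_of_deriv (convex_Icc 0 1) (by fun_prop)
    (fun x hx => (hder x hx).differentiableAt.differentiableWithinAt) ?_
  intro x hx y hy hxy
  rw [(hder x hx).deriv, (hder y hy).deriv]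
  rw [interior_Icc] at hx hy
  -- The derivative is antitone once `log x - log y ≤ x - y`; this uses `log t ≤ t - 1` at `t = x /
  -- y`, then `x ≤ y < 1`.
  have h := Real.log_le_sub_one_of_pos (div_pos hx.1 hy.1)
  rw [Real.log_div hx.1.ne' hy.1.ne'] at h
  have h2 : x / y - 1 ≤ x - y := by
    have hy0 := hy.1
    rw [sub_le_iff_le_add, div_le_iff₀ hy.1]
    nlinarith [hy.2]
  linarith

/-- Spectral sums of `-x log x + x² / 2` are still midpoint concave, so the entropy gains at least
half of what the trace of the square loses, which is `tr (A - B)² / 4`. Hence the `8`; `log 2` is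
the change of base. -/
theorem entropy_midpoint_gap {A B : Matrix n n ℂ} (hA : IsDensity A) (hB : IsDensity B) :
    ((A - B) * (A - B)).trace.re / (8 * Real.log 2) ≤
      entropy ((1 / 2 : ℂ) • A + (1 / 2 : ℂ) • B) - (entropy A + entropy B) / 2 := by
  have hC : ((1 / 2 : ℂ) • A + (1 / 2 : ℂ) • B).IsHermitian := by
    simp [IsHermitian, hA.1.1.eq, hB.1.1.eq]
  have h := specSum_midpoint concaveOn_negMulLog_add_sq hA.1.1 hB.1.1
    hA.eigenvalues_mem_Icc hB.eigenvalues_mem_Icc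
  have split : ∀ {X : Matrix n n ℂ}, X.IsHermitian →
      specSum (fun x : ℝ => Real.negMulLog x + x * x / 2) X
        = entropy X * Real.log 2 + (X * X).trace.re / 2 := by
    intro X hX
    have hl : Real.log 2 ≠ 0 := (Real.log_pos one_lt_two).ne'
    rw [entropy_eq_specSum hX, div_mul_cancel₀ _ hl, ← specSum_sq hX]
    simp only [specSum_eq_sum_eigenvalues _ hX, Finset.sum_add_distrib, Finset.sum_div]
  rw [split hA.1.1, split hB.1.1, split hC] at h
  have ht : (A * B).trace = (B * A).trace := trace_mul_comm _ _
  have e1 : ((A - B) * (A - B)).trace.re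
      = (A * A).trace.re + (B * B).trace.re - 2 * (A * B).trace.re := by
    simp only [mul_sub, sub_mul, trace_sub, ← ht, Complex.sub_re]; ring
  have e2 : (((1 / 2 : ℂ) • A + (1 / 2 : ℂ) • B) * ((1 / 2 : ℂ) • A + (1 / 2 : ℂ) • B)).trace.re
      = ((A * A).trace.re + (B * B).trace.re + 2 * (A * B).trace.re) / 4 := by
    have : ((1 / 2 : ℂ) • A + (1 / 2 : ℂ) • B) * ((1 / 2 : ℂ) • A + (1 / 2 : ℂ) • B)
        = (1 / 4 : ℝ) • (A * A + B * B + (A * B + B * A)) := by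
      ext i j
      simp [mul_add, add_mul]; ring
    rw [this]
    simp only [trace_smul, trace_add, ← ht, Complex.add_re, Complex.smul_re, smul_eq_mul]; ring
  rw [e2] at h
  rw [e1, div_le_iff₀ (mul_pos (by norm_num) (Real.log_pos one_lt_two))]
  linarith

end Spectral

/-! ### Separable states: the marginal has no more entropy than the whole. -/

section Separable

open Matrix

variable {α β : Type*} [Fintype α] [DecidableEq α] [Fintype β] [DecidableEq β]

/-- The state and its marginal have the nonzero spectra of the Gram matrices `Wᴴ * W` and `Tᴴ * T`.
The former is the entrywise product of the latter with the Gram matrix of the unit vectors `a i`,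
and such a product is a bistochastic map with diagonal Kraus operators. -/
theorem entropy_traceFst_le_of_pure {N : Type*} [Fintype N] [DecidableEq N]
    (a : N → α → ℂ) (b : N → β → ℂ) (ha : ∀ i, ∑ x, star (a i x) * a i x = 1)
    (W : Matrix (α × β) N ℂ) (hW : W = of fun r i => a i r.1 * b i r.2) :
    entropy (traceFst (W * Wᴴ)) ≤ entropy (W * Wᴴ) := by
  let T : Matrix β N ℂ := of fun y i => b i y
  have hT : traceFst (W * Wᴴ) = T * Tᴴ := by
    ext y y'
    simp only [traceFst, hW, of_apply, mul_apply, conjTranspose_apply, star_mul', T]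
    rw [Finset.sum_comm]
    refine Finset.sum_congr rfl fun i _ => ?_
    calc _ = (∑ x, star (a i x) * a i x) * (b i y * star (b i y')) := by
          rw [Finset.sum_mul]; exact Finset.sum_congr rfl fun x _ => by ring
      _ = _ := by rw [ha, one_mul]
  have hG : Wᴴ * W = ∑ x, diagonal (fun i => star (a i x)) * (Tᴴ * T)
      * (diagonal (fun i => star (a i x)))ᴴ := by
    ext i j
    simp only [Matrix.sum_apply, diagonal_conjTranspose, mul_diagonal, diagonal_mul]
    simp only [hW, T, of_apply, mul_apply, conjTranspose_apply, star_mul', Fintype.sum_prod_type,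
      Pi.star_apply, star_star, Finset.mul_sum, Finset.sum_mul]
    exact Finset.sum_congr rfl fun x _ => Finset.sum_congr rfl fun y _ => by ring
  have hTp := posSemidef_conjTranspose_mul_self T
  have h1 : ∑ x, diagonal (fun i => star (a i x)) * (diagonal (fun i => star (a i x)))ᴴ
      = 1 := by
    simp only [diagonal_conjTranspose, diagonal_mul_diagonal, Pi.star_apply, star_star]
    ext i j
    by_cases hij : i = j
    · subst hij; simpa [Matrix.sum_apply] using ha i
    · simp [Matrix.sum_apply, hij]
  have h2 : ∑ x, (diagonal (fun i => star (a i x)))ᴴ * diagonal (fun i => star (a i x))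
      = 1 := by
    rw [← h1]
    refine Finset.sum_congr rfl fun x _ => ?_
    simp only [diagonal_conjTranspose, diagonal_mul_diagonal, Pi.star_apply, star_star, mul_comm]
  rw [hT, entropy_eq_specSum (posSemidef_self_mul_conjTranspose T).1,
    entropy_eq_specSum (posSemidef_self_mul_conjTranspose W).1,
    specSum_mul_comm Real.negMulLog_zero T, specSum_mul_comm Real.negMulLog_zero W, hG]
  exact div_le_div_of_nonneg_right (specSum_le_of_bistochastic Real.concaveOn_negMulLog hTp.1
    (fun i => hTp.eigenvalues_nonneg i) _ h1 h2) (Real.log_nonneg one_le_two)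

theorem IsSeparable.entropy_traceFst_le {σ : Matrix (α × β) (α × β) ℂ} (hσ : IsSeparable σ) :
    entropy (traceFst σ) ≤ entropy σ := by
  obtain ⟨m, q, a, b, hq, -, ha, hb, rfl⟩ := hσ
  choose U hU₁ _ hUa using fun i => exists_diagonalization (ha i).1.1
  choose V _ _ hVb using fun i => exists_diagonalization (hb i).1.1
  let c : Fin m × α × β → ℝ := fun i =>
    q i.1 * (ha i.1).1.1.eigenvalues i.2.1 * (hb i.1).1.1.eigenvalues i.2.2
  have hc : ∀ i, 0 ≤ c i := fun i => mul_nonneg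
    (mul_nonneg (hq _) ((ha _).1.eigenvalues_nonneg _)) ((hb _).1.eigenvalues_nonneg _)
  -- The columns are product eigenvectors. The whole weight goes into the second factor, so that the
  -- first factors stay unit vectors.
  let W : Matrix (α × β) (Fin m × α × β) ℂ :=
    of fun r i => U i.1 r.1 i.2.1 * (Real.sqrt (c i) * V i.1 r.2 i.2.2)
  have hW : ∑ i, (q i : ℂ) • (a i ⊗ₖ b i) = W * Wᴴ := by
    ext ⟨x, y⟩ ⟨x', y'⟩
    have ha' : ∀ i, a i x x' = ∑ s, U i x s * (ha i).1.1.eigenvalues s * star (U i x' s) :=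
      fun i => by
        conv_lhs => rw [hUa i]
        simp [mul_apply (M := _ * diagonal _), mul_diagonal]
    have hb' : ∀ i, b i y y' = ∑ t, V i y t * (hb i).1.1.eigenvalues t * star (V i y' t) :=
      fun i => by
        conv_lhs => rw [hVb i]
        simp [mul_apply (M := _ * diagonal _), mul_diagonal]
    have hs : ∀ i, (c i : ℂ) = Real.sqrt (c i) * Real.sqrt (c i) := fun i => by
      rw [← Complex.ofReal_mul, Real.mul_self_sqrt (hc i)]
    simp only [Matrix.sum_apply, Matrix.smul_apply, kroneckerMap_apply, smul_eq_mul, mul_apply,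
      conjTranspose_apply, ha', hb', Fintype.sum_prod_type, W, of_apply, star_mul']
    refine Finset.sum_congr rfl fun i _ => ?_
    rw [Finset.sum_mul_sum, Finset.mul_sum]
    refine Finset.sum_congr rfl fun s _ => ?_
    rw [Finset.mul_sum]
    refine Finset.sum_congr rfl fun t _ => ?_
    have h := hs (i, s, t)
    simp only [c, Complex.ofReal_mul] at h
    simp only [RCLike.star_def, Complex.conj_ofReal, c]
    linear_combination (U i x s * starRingEnd ℂ (U i x' s) *
      (V i y t * starRingEnd ℂ (V i y' t))) * h
  rw [hW]
  refine entropy_traceFst_le_of_pure (fun i x => U i.1 x i.2.1)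
    (fun i y => Real.sqrt (c i) * V i.1 y i.2.2) (fun i => ?_) W rfl
  have := congrFun (congrFun (hU₁ i.1) i.2.1) i.2.1
  simpa [mul_apply] using this

end Separable

/-! ### Tensor products of matrices and additivity of the entropy. -/

section PiTensor

open Matrix

variable {n : ℕ} {ι κ μ : Type*}

/-- The tensor product of `n` matrices, in the product basis. -/
def piTensor (A : Fin n → Matrix ι κ ℂ) : Matrix (Fin n → ι) (Fin n → κ) ℂ :=
  of fun x y => ∏ k, A k (x k) (y k)

theorem piTensor_mul [Fintype κ] (A : Fin n → Matrix ι κ ℂ) (B : Fin n → Matrix κ μ ℂ) :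
    piTensor A * piTensor B = piTensor fun k => A k * B k := by
  ext x y
  simp only [piTensor, mul_apply, of_apply, Finset.prod_univ_sum, Fintype.piFinset_univ,
    Finset.prod_mul_distrib]

theorem piTensor_conjTranspose (A : Fin n → Matrix ι κ ℂ) :
    (piTensor A)ᴴ = piTensor fun k => (A k)ᴴ := by
  ext x y
  simp [piTensor]

theorem piTensor_diagonal [DecidableEq ι] (d : Fin n → ι → ℂ) :
    piTensor (fun k => diagonal (d k)) = diagonal fun x => ∏ k, d k (x k) := by
  ext x y
  by_cases h : x = y
  · subst h; simp [piTensor]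
  · obtain ⟨k, hk⟩ := Function.ne_iff.mp h
    rw [diagonal_apply_ne _ h]
    exact Finset.prod_eq_zero (Finset.mem_univ k) (diagonal_apply_ne _ hk)

theorem piTensor_one [DecidableEq ι] : piTensor (fun _ : Fin n => (1 : Matrix ι ι ℂ)) = 1 := by
  simpa using piTensor_diagonal fun (_ : Fin n) (_ : ι) => (1 : ℂ)

theorem sum_piTensor {N : Type*} [Fintype N] (A : Fin n → N → Matrix ι κ ℂ) :
    ∑ i : Fin n → N, piTensor (fun k => A k (i k)) = piTensor fun k => ∑ j, A k j := by
  ext x y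
  simp only [piTensor, Matrix.sum_apply, of_apply, Finset.prod_univ_sum, Fintype.piFinset_univ]

theorem trace_piTensor [Fintype ι] (A : Fin n → Matrix ι ι ℂ) :
    (piTensor A).trace = ∏ k, (A k).trace := by
  simp only [piTensor, trace, diag_apply, of_apply, Finset.prod_univ_sum, Fintype.piFinset_univ]

open scoped MatrixOrder Matrix.Norms.L2Operator in
theorem exists_eq_conjTranspose_mul_self [Fintype ι] [DecidableEq ι] {A : Matrix ι ι ℂ}
    (hA : A.PosSemidef) : ∃ B : Matrix ι ι ℂ, A = Bᴴ * B :=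
  CStarAlgebra.nonneg_iff_eq_star_mul_self.mp hA.nonneg

theorem piTensor_posSemidef [Fintype ι] [DecidableEq ι] {A : Fin n → Matrix ι ι ℂ}
    (hA : ∀ k, (A k).PosSemidef) : (piTensor A).PosSemidef := by
  choose B hB using fun k => exists_eq_conjTranspose_mul_self (hA k)
  rw [funext hB, ← piTensor_mul, ← piTensor_conjTranspose]
  exact posSemidef_conjTranspose_mul_self _

theorem piTensor_isDensity [Fintype ι] [DecidableEq ι] {A : Fin n → Matrix ι ι ℂ}
    (hA : ∀ k, IsDensity (A k)) : IsDensity (piTensor A) :=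
  ⟨piTensor_posSemidef fun k => (hA k).1, by simp [trace_piTensor, (hA _).2]⟩

/-- Additivity of Shannon entropy for independent variables: peel off one coordinate with the
product rule for `negMulLog`. -/
theorem sum_negMulLog_prod [Fintype ι] [DecidableEq ι] (d : Fin n → ι → ℝ)
    (hd : ∀ k, ∑ i, d k i = 1) :
    ∑ x : Fin n → ι, Real.negMulLog (∏ k, d k (x k)) = ∑ k, ∑ i, Real.negMulLog (d k i) := by
  induction n with
  | zero => simp
  | succ n ih =>
    rw [Fin.sum_univ_succ, ← ih (fun k => d k.succ) fun k => hd _,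
      ← (Fin.consEquiv fun _ => ι).sum_comp, Fintype.sum_prod_type]
    simp only [Fin.consEquiv_apply, Fin.prod_univ_succ, Fin.cons_zero, Fin.cons_succ,
      Real.negMulLog_mul, Finset.sum_add_distrib, ← Finset.sum_mul, ← Finset.mul_sum, hd, one_mul]
    have : ∑ x : Fin n → ι, ∏ k, d k.succ (x k) = 1 := by
      rw [← Fintype.piFinset_univ, ← Finset.prod_univ_sum]
      simp [hd]
    simp [this]

theorem entropy_piTensor [Fintype ι] [DecidableEq ι] {A : Fin n → Matrix ι ι ℂ}
    (hA : ∀ k, IsDensity (A k)) : entropy (piTensor A) = ∑ k, entropy (A k) := by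
  choose U hU₁ _ hUA using fun k => exists_diagonalization (hA k).1.1
  have hd : piTensor A = piTensor U
      * diagonal (fun x => ∏ k, ((hA k).1.1.eigenvalues (x k) : ℂ)) * (piTensor U)ᴴ := by
    rw [← piTensor_diagonal fun k i => ((hA k).1.1.eigenvalues i : ℂ), piTensor_conjTranspose,
      piTensor_mul, piTensor_mul]
    exact congrArg _ (funext hUA)
  have hU : (piTensor U)ᴴ * piTensor U = 1 := by
    rw [piTensor_conjTranspose, piTensor_mul, funext hU₁, piTensor_one]
  rw [entropy_eq_specSum (piTensor_isDensity hA).1.1, hd, specSum_conj hU, specSum_diagonal]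
  simp only [entropy_eq_specSum (hA _).1.1, specSum_eq_sum_eigenvalues _ (hA _).1.1,
    ← Finset.sum_div, ← Complex.ofReal_prod, Complex.ofReal_re]
  rw [sum_negMulLog_prod _ fun k => IsDensity.sum_eigenvalues (hA k)]

end PiTensor

/-! ### Measure-and-prepare channels and their vanishing coherent information. -/

section MeasurePrepare

open Matrix

variable {ι κ : Type*} [Fintype ι] [DecidableEq ι] [Fintype κ] [DecidableEq κ]

/-- A channel that measures a POVM `M` and prepares a state `τ k` on outcome `k`. -/
def IsMeasurePrepare (Φ : Matrix ι ι ℂ →ₗ[ℂ] Matrix κ κ ℂ) : Prop :=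
  ∃ (N : ℕ) (M : Fin N → Matrix ι ι ℂ) (τ : Fin N → Matrix κ κ ℂ),
    (∀ k, (M k).PosSemidef) ∧ ∑ k, M k = 1 ∧ (∀ k, IsDensity (τ k)) ∧
    ∀ X, Φ X = ∑ k, (M k * X).trace • τ k

theorem IsMeasurePrepare.of_fintype {N : Type*} [Fintype N]
    {Φ : Matrix ι ι ℂ →ₗ[ℂ] Matrix κ κ ℂ}
    (M : N → Matrix ι ι ℂ) (τ : N → Matrix κ κ ℂ) (hM : ∀ k, (M k).PosSemidef)
    (hM₁ : ∑ k, M k = 1) (hτ : ∀ k, IsDensity (τ k))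
    (h : ∀ X, Φ X = ∑ k, (M k * X).trace • τ k) : IsMeasurePrepare Φ := by
  let e := (Fintype.equivFin N).symm
  refine ⟨_, M ∘ e, τ ∘ e, fun k => hM _, ?_, fun k => hτ _, fun X => ?_⟩
  · rw [← hM₁]; exact e.sum_comp M
  · rw [h]; exact (e.sum_comp fun k => (M k * X).trace • τ k).symm

theorem isDensity_single (i : ι) : IsDensity (single i i (1 : ℂ)) := by
  refine ⟨?_, by simp⟩
  have := posSemidef_vecMulVec_self_star (Pi.single i (1 : ℂ))
  convert this using 1
  ext a b
  by_cases ha : i = a <;> by_cases hb : i = b <;>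
    simp [vecMulVec_apply, single_apply, Pi.single_apply, ha, hb, eq_comm]

theorem nonempty_of_isDensity {ρ : Matrix ι ι ℂ} (hρ : IsDensity ρ) : Nonempty ι := by
  by_contra h
  rw [not_nonempty_iff] at h
  simpa [trace] using hρ.2

/-- The conditional operator on the ancilla after the outcome `M`. -/
def ancillaOutcome {α : Type*} (M : Matrix ι ι ℂ) (X : Matrix (α × ι) (α × ι) ℂ) :
    Matrix α α ℂ :=
  of fun r s => (M * of fun i j => X (r, i) (s, j)).trace

/-- With `M = Bᴴ * B`, the conditional operator has a Kraus form whose operators `C l` are the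
identity on the ancilla tensored with the rows of `B`. -/
theorem ancillaOutcome_posSemidef {α : Type*} [Fintype α] [DecidableEq α] {M : Matrix ι ι ℂ}
    (hM : M.PosSemidef) {X : Matrix (α × ι) (α × ι) ℂ} (hX : X.PosSemidef) :
    (ancillaOutcome M X).PosSemidef := by
  obtain ⟨B, rfl⟩ := exists_eq_conjTranspose_mul_self hM
  let C : ι → Matrix α (α × ι) ℂ := fun l => of fun r p => if r = p.1 then B l p.2 else 0
  have h : ancillaOutcome (Bᴴ * B) X = ∑ l, C l * X * (C l)ᴴ := by
    ext r s
    simp only [ancillaOutcome, of_apply, trace, diag_apply, mul_apply, Matrix.sum_apply,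
      conjTranspose_apply, C, Fintype.sum_prod_type, apply_ite star, star_zero, ite_mul, mul_ite,
      zero_mul, mul_zero, Finset.sum_mul, Finset.sum_ite_irrel, Finset.sum_const_zero,
      Finset.sum_ite_eq, Finset.mem_univ, if_true]
    calc ∑ i, ∑ j, ∑ l, star (B l i) * B l j * X (r, j) (s, i)
        = ∑ i, ∑ l, ∑ j, star (B l i) * B l j * X (r, j) (s, i) :=
          Finset.sum_congr rfl fun _ _ => Finset.sum_comm
      _ = ∑ l, ∑ i, ∑ j, star (B l i) * B l j * X (r, j) (s, i) := Finset.sum_comm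
      _ = _ := Finset.sum_congr rfl fun l _ => Finset.sum_congr rfl fun i _ =>
          Finset.sum_congr rfl fun j _ => by ring
  rw [h]
  exact posSemidef_sum _ fun l _ => hX.mul_mul_conjTranspose_same (C l)

theorem trace_sum_ancillaOutcome {α N : Type*} [Fintype α] [Fintype N] {M : N → Matrix ι ι ℂ}
    (hM : ∑ k, M k = 1) (X : Matrix (α × ι) (α × ι) ℂ) :
    ∑ k, (ancillaOutcome (M k) X).trace = X.trace := by
  calc ∑ k, (ancillaOutcome (M k) X).trace
      = ∑ k, ∑ r, (M k * of fun i j => X (r, i) (r, j)).trace := rfl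
    _ = ∑ r, ∑ k, (M k * of fun i j => X (r, i) (r, j)).trace := Finset.sum_comm
    _ = X.trace := by
      simp only [← trace_sum, ← Matrix.sum_mul, hM, Matrix.one_mul]
      simp only [trace, Fintype.sum_prod_type, diag_apply, Matrix.sum_apply, of_apply]
      exact Finset.sum_comm

theorem idTensor_eq_sum_kronecker {N : Type*} [Fintype N] (α : Type*)
    {Φ : Matrix ι ι ℂ →ₗ[ℂ] Matrix κ κ ℂ}
    {M : N → Matrix ι ι ℂ} {τ : N → Matrix κ κ ℂ}
    (h : ∀ X, Φ X = ∑ k, (M k * X).trace • τ k) (X : Matrix (α × ι) (α × ι) ℂ) :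
    idTensor α Φ X = ∑ k, ancillaOutcome (M k) X ⊗ₖ τ k := by
  ext r s
  simp [idTensor, h, Matrix.sum_apply, ancillaOutcome]

theorem IsMeasurePrepare.isSeparable {α : Type*} [Fintype α] [DecidableEq α]
    {Φ : Matrix ι ι ℂ →ₗ[ℂ] Matrix κ κ ℂ} (hΦ : IsMeasurePrepare Φ)
    {ρ : Matrix (α × ι) (α × ι) ℂ} (hρ : IsDensity ρ) : IsSeparable (idTensor α Φ ρ) := by
  obtain ⟨N, M, τ, hM, hM₁, hτ, h⟩ := hΦ
  obtain ⟨⟨x, -⟩⟩ := nonempty_of_isDensity hρ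
  let A := fun k => ancillaOutcome (M k) ρ
  have hA : ∀ k, (A k).PosSemidef := fun k => ancillaOutcome_posSemidef (hM k) hρ.1
  have htr : ∀ k, ((A k).trace.re : ℂ) = (A k).trace := fun k =>
    (Complex.eq_re_of_ofReal_le (hA k).trace_nonneg).symm
  refine ⟨N, fun k => (A k).trace.re,
    -- An outcome of probability zero gets an arbitrary state; there `A k` vanishes, being positive
    -- of trace zero.
    fun k => if (A k).trace = 0 then single x x 1 else (A k).trace⁻¹ • A k, τ,
    fun k => (Complex.nonneg_iff.mp (hA k).trace_nonneg).1, ?_, fun k => ?_, hτ, ?_⟩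
  · have := trace_sum_ancillaOutcome hM₁ ρ
    rw [hρ.2] at this
    simpa using congrArg Complex.re this
  · beta_reduce
    split_ifs with h0
    · exact isDensity_single x
    · refine ⟨(hA k).smul ?_, ?_⟩
      · exact inv_nonneg.mpr (hA k).trace_nonneg
      · rw [trace_smul, smul_eq_mul, inv_mul_cancel₀ h0]
  · rw [idTensor_eq_sum_kronecker α h]
    refine Finset.sum_congr rfl fun k _ => ?_
    simp only [htr]
    split_ifs with h0
    · rw [h0, zero_smul]
      change A k ⊗ₖ τ k = 0
      rw [(hA k).trace_eq_zero_iff.mp h0, zero_kronecker]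
    · rw [smul_kronecker, smul_smul, mul_inv_cancel₀ h0, one_smul]

theorem IsMeasurePrepare.isEntanglementBreaking {Φ : Matrix ι ι ℂ →ₗ[ℂ] Matrix κ κ ℂ}
    (hΦ : IsMeasurePrepare Φ) : IsEntanglementBreaking Φ := by
  refine ⟨⟨fun n X hX => ?_, fun X => ?_⟩, fun n ρ hρ => hΦ.isSeparable hρ⟩
  · obtain ⟨N, M, τ, hM, -, hτ, h⟩ := hΦ
    rw [idTensor_eq_sum_kronecker _ h]
    exact posSemidef_sum _ fun k _ => (ancillaOutcome_posSemidef (hM k) hX).kronecker (hτ k).1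
  · obtain ⟨N, M, τ, -, hM₁, hτ, h⟩ := hΦ
    simp only [h, trace_sum, trace_smul, (hτ _).2, smul_eq_mul, mul_one]
    rw [← trace_sum, ← Matrix.sum_mul, hM₁, Matrix.one_mul]

theorem IsMeasurePrepare.tensorPower {Φ : Matrix ι ι ℂ →ₗ[ℂ] Matrix κ κ ℂ}
    (hΦ : IsMeasurePrepare Φ) (n : ℕ) : IsMeasurePrepare (tensorPower Φ n) := by
  obtain ⟨N, M, τ, hM, hM₁, hτ, h⟩ := hΦ
  refine .of_fintype (N := Fin n → Fin N) (fun i => piTensor fun k => M (i k))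
    (fun i => piTensor fun k => τ (i k)) (fun i => piTensor_posSemidef fun k => hM _) ?_
    (fun i => piTensor_isDensity fun k => hτ _) fun X => ?_
  · rw [sum_piTensor fun _ => M, hM₁, piTensor_one]
  · ext x y
    have hs : ∀ (a b : ι) (u v : κ), Φ (single a b 1) u v = ∑ k, M k b a * τ k u v := by
      intro a b u v
      simp [h, Matrix.sum_apply, trace_mul_single]
    simp only [QSwitch.tensorPower, LinearMap.coe_mk, AddHom.coe_mk, of_apply, hs,
      Finset.prod_univ_sum, Fintype.piFinset_univ, Matrix.sum_apply, Matrix.smul_apply,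
      smul_eq_mul, trace, diag_apply, mul_apply, piTensor, Finset.mul_sum, Finset.sum_mul,
      Finset.prod_mul_distrib]
    calc _ = ∑ p : Fin n → ι, ∑ i : Fin n → Fin N, ∑ q : Fin n → ι,
          X p q * ((∏ k, M (i k) (q k) (p k)) * ∏ k, τ (i k) (x k) (y k)) :=
          Finset.sum_congr rfl fun _ _ => Finset.sum_comm
      _ = _ := Finset.sum_comm
      _ = _ := by
        refine Finset.sum_congr rfl fun i _ => ?_
        rw [Finset.sum_comm]
        exact Finset.sum_congr rfl fun q _ => Finset.sum_congr rfl fun p _ => by ring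

/-- Tensoring with a basis projection is conjugation by an isometry `J`, which only adds zero
eigenvalues. -/
theorem entropy_single_kronecker {α : Type*} [Fintype α] [DecidableEq α] (a : α)
    {τ : Matrix κ κ ℂ} (hτ : τ.IsHermitian) :
    entropy (single a a (1 : ℂ) ⊗ₖ τ) = entropy τ := by
  let J : Matrix (α × κ) κ ℂ := of fun r y => if a = r.1 ∧ r.2 = y then 1 else 0
  have hJ : Jᴴ * J = 1 := by
    ext y y'
    simp only [mul_apply, conjTranspose_apply, J, of_apply, Fintype.sum_prod_type, one_apply]
    by_cases h : y = y'
    · simp [h, ite_and]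
    · simp [h, Ne.symm h, ite_and]
  have hs : single a a (1 : ℂ) ⊗ₖ τ = J * τ * Jᴴ := by
    ext ⟨r, y⟩ ⟨s, y'⟩
    rcases eq_or_ne a r with rfl | hr <;> rcases eq_or_ne a s with rfl | hs' <;>
      simp [mul_apply, J, *]
  have hH : (single a a (1 : ℂ) ⊗ₖ τ).IsHermitian := by
    rw [hs]
    simp only [IsHermitian, conjTranspose_mul, conjTranspose_conjTranspose, hτ.eq,
      Matrix.mul_assoc]
  rw [entropy_eq_specSum hH, entropy_eq_specSum hτ, hs, Matrix.mul_assoc,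
    specSum_mul_comm Real.negMulLog_zero, Matrix.mul_assoc, hJ, Matrix.mul_one]

/-- Separability of the outputs gives the upper bound; a pure product input attains zero. -/
theorem IsMeasurePrepare.coherentInfo_eq_zero [Nonempty ι]
    {Φ : Matrix ι ι ℂ →ₗ[ℂ] Matrix κ κ ℂ} (hΦ : IsMeasurePrepare Φ) : coherentInfo Φ = 0 := by
  have hle : ∀ h ∈ {h : ℝ | ∃ ρ : Matrix (ι × ι) (ι × ι) ℂ,
      IsDensity ρ ∧ h = stateCoherentInfo (idTensor ι Φ ρ)}, h ≤ 0 := by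
    rintro _ ⟨ρ, hρ, rfl⟩
    exact sub_nonpos.mpr (hΦ.isSeparable hρ).entropy_traceFst_le
  refine le_antisymm (Real.sSup_nonpos hle) (le_csSup ⟨0, hle⟩ ?_)
  obtain ⟨i⟩ := ‹Nonempty ι›
  refine ⟨single (i, i) (i, i) 1, isDensity_single _, ?_⟩
  have hid : idTensor ι Φ (single (i, i) (i, i) 1) = single i i (1 : ℂ) ⊗ₖ Φ (single i i 1) := by
    ext ⟨r, x⟩ ⟨s, y⟩
    simp only [idTensor, of_apply, kroneckerMap_apply]
    have : (of fun a b => single (i, i) (i, i) (1 : ℂ) (r, a) (s, b))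
        = single i i (1 : ℂ) r s • single i i (1 : ℂ) := by
      ext a b
      simp only [of_apply, Matrix.smul_apply, single_apply, Prod.mk.injEq, smul_eq_mul]
      rcases eq_or_ne i r with rfl | h₁ <;> rcases eq_or_ne i s with rfl | h₂ <;> simp [*]
    rw [this, map_smul, Matrix.smul_apply, smul_eq_mul]
  have htr : traceFst (single i i (1 : ℂ) ⊗ₖ Φ (single i i 1)) = Φ (single i i 1) := by
    ext x y
    simp [traceFst, single_apply]
  have hH : (Φ (single i i 1)).IsHermitian := by
    obtain ⟨N, M, τ, hM, -, hτ, h⟩ := hΦ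
    rw [h]
    refine (posSemidef_sum _ fun k _ => (hτ k).1.smul ?_).1
    rw [trace_mul_single]
    simpa using (hM k).diag_nonneg
  rw [stateCoherentInfo, hid, htr, entropy_single_kronecker i hH, sub_self]

theorem IsMeasurePrepare.hasQuantumCapacity_zero [Nonempty ι]
    {Φ : Matrix ι ι ℂ →ₗ[ℂ] Matrix κ κ ℂ} (hΦ : IsMeasurePrepare Φ) :
    HasQuantumCapacity Φ 0 := by
  simp [HasQuantumCapacity, (hΦ.tensorPower _).coherentInfo_eq_zero]

end MeasurePrepare

/-! ### Zero classical capacity forces complete erasure. -/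

section Capacity

open Matrix

variable {ι κ : Type*} [Fintype ι] [DecidableEq ι] [Fintype κ] [DecidableEq κ]

theorem IsKraus.map_posSemidef {ν : Type*} [Fintype ν] {Φ : Matrix ι ι ℂ →ₗ[ℂ] Matrix κ κ ℂ}
    {K : ν → Matrix κ ι ℂ} (hK : IsKraus Φ K) {X : Matrix ι ι ℂ} (hX : X.PosSemidef) :
    (Φ X).PosSemidef := by
  rw [hK]
  exact posSemidef_sum _ fun i _ => hX.mul_mul_conjTranspose_same _

theorem IsChannel.map_isDensity {Φ : Matrix ι ι ℂ →ₗ[ℂ] Matrix κ κ ℂ} (hΦ : IsChannel Φ)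
    {ρ : Matrix ι ι ℂ} (hρ : IsDensity ρ) : IsDensity (Φ ρ) := by
  obtain ⟨m, K, hK⟩ := exists_isKraus Φ hΦ.1
  exact ⟨hK.map_posSemidef hρ.1, by rw [hΦ.2, hρ.2]⟩

theorem IsKraus.tensorPower {ν : Type*} [Fintype ν] {Φ : Matrix ι ι ℂ →ₗ[ℂ] Matrix κ κ ℂ}
    {K : ν → Matrix κ ι ℂ} (hK : IsKraus Φ K) (n : ℕ) :
    IsKraus (tensorPower Φ n) fun i : Fin n → ν => piTensor fun k => K (i k) := by
  intro X
  ext x y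
  have hs : ∀ (a b : ι) (u v : κ), Φ (single a b 1) u v = ∑ k, K k u a * star (K k v b) := by
    intro a b u v
    rw [hK]
    simp [Matrix.sum_apply, mul_apply, single_apply, ite_and]
  simp only [QSwitch.tensorPower, LinearMap.coe_mk, AddHom.coe_mk, of_apply, hs,
    Finset.prod_univ_sum, Fintype.piFinset_univ, Matrix.sum_apply, conjTranspose_apply,
    mul_apply, piTensor, Finset.mul_sum, Finset.sum_mul, Finset.prod_mul_distrib, star_prod]
  calc _ = ∑ p : Fin n → ι, ∑ i : Fin n → ν, ∑ q : Fin n → ι,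
        X p q * ((∏ k, K (i k) (x k) (p k)) * ∏ k, star (K (i k) (y k) (q k))) :=
        Finset.sum_congr rfl fun _ _ => Finset.sum_comm
    _ = _ := Finset.sum_comm
    _ = _ := by
      refine Finset.sum_congr rfl fun i _ => ?_
      rw [Finset.sum_comm]
      exact Finset.sum_congr rfl fun q _ => Finset.sum_congr rfl fun p _ => by ring

theorem trace_tensorPower {Φ : Matrix ι ι ℂ →ₗ[ℂ] Matrix κ κ ℂ}
    (hΦ : ∀ X, (Φ X).trace = X.trace) (n : ℕ) (X : Matrix (Fin n → ι) (Fin n → ι) ℂ) :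
    (tensorPower Φ n X).trace = X.trace := by
  have h : ∀ p q : Fin n → ι, ∑ x : Fin n → κ, ∏ k, Φ (single (p k) (q k) 1) (x k) (x k)
      = if p = q then 1 else 0 := by
    intro p q
    rw [← Fintype.piFinset_univ,
      ← Finset.prod_univ_sum _ fun k u => Φ (single (p k) (q k) 1) u u]
    have : ∀ k, ∑ u, Φ (single (p k) (q k) 1) u u = if p k = q k then 1 else 0 := fun k => by
      refine (hΦ (single (p k) (q k) 1)).trans ?_
      by_cases h : p k = q k
      · simp [h]
      · simp [h, trace_single_eq_of_ne]
    simp only [this, Finset.prod_ite_zero, Finset.prod_const_one, Finset.mem_univ, true_imp_iff,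
      funext_iff]
  simp only [trace, diag_apply, tensorPower, LinearMap.coe_mk, AddHom.coe_mk, of_apply]
  rw [Finset.sum_comm]
  refine Finset.sum_congr rfl fun p _ => ?_
  rw [Finset.sum_comm]
  simp only [← Finset.mul_sum, h, mul_ite, mul_one, mul_zero, Finset.sum_ite_eq,
    Finset.mem_univ, if_true]

theorem IsChannel.tensorPower_isDensity {Φ : Matrix ι ι ℂ →ₗ[ℂ] Matrix κ κ ℂ}
    (hΦ : IsChannel Φ) (n : ℕ) {ρ : Matrix (Fin n → ι) (Fin n → ι) ℂ} (hρ : IsDensity ρ) :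
    IsDensity (tensorPower Φ n ρ) := by
  obtain ⟨m, K, hK⟩ := exists_isKraus Φ hΦ.1
  exact ⟨(hK.tensorPower n).map_posSemidef hρ.1, by rw [trace_tensorPower hΦ.2, hρ.2]⟩

theorem tensorPower_piTensor (Φ : Matrix ι ι ℂ →ₗ[ℂ] Matrix κ κ ℂ) {n : ℕ}
    (A : Fin n → Matrix ι ι ℂ) :
    tensorPower Φ n (piTensor A) = piTensor fun k => Φ (A k) := by
  ext x y
  have hs : ∀ (X : Matrix ι ι ℂ) (u v : κ),
      Φ X u v = ∑ a, ∑ b, X a b * Φ (single a b 1) u v := by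
    intro X u v
    conv_lhs => rw [matrix_eq_sum_single X]
    have : ∀ i j, single i j (X i j) = X i j • single i j (1 : ℂ) := by
      intro i j; simp
    simp only [map_sum, this, map_smul, Matrix.sum_apply, Matrix.smul_apply, smul_eq_mul]
  simp only [piTensor, of_apply, hs (A _), tensorPower, LinearMap.coe_mk, AddHom.coe_mk,
    Finset.prod_univ_sum, Fintype.piFinset_univ, Finset.prod_mul_distrib]

theorem isDensity_mixture {N : Type*} [Fintype N] {p : N → ℝ} (hp : ∀ x, 0 ≤ p x)
    (hp₁ : ∑ x, p x = 1) {ρ : N → Matrix ι ι ℂ} (hρ : ∀ x, IsDensity (ρ x)) :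
    IsDensity (∑ x, (p x : ℂ) • ρ x) := by
  refine ⟨posSemidef_sum _ fun x _ => (hρ x).1.smul (by exact_mod_cast hp x), ?_⟩
  simp only [trace_sum, trace_smul, (hρ _).2, smul_eq_mul, mul_one]
  exact_mod_cast hp₁

/-- The substance is boundedness of the set, without which the real `sSup` would default to zero;
ensembles may also be indexed by any finite type. -/
theorem le_holevo {Φ : Matrix ι ι ℂ →ₗ[ℂ] Matrix κ κ ℂ}
    (hΦ : ∀ ρ, IsDensity ρ → IsDensity (Φ ρ)) {N : Type*} [Fintype N] {p : N → ℝ}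
    (hp : ∀ x, 0 ≤ p x) (hp₁ : ∑ x, p x = 1) {ρ : N → Matrix ι ι ℂ}
    (hρ : ∀ x, IsDensity (ρ x)) :
    entropy (∑ x, (p x : ℂ) • Φ (ρ x)) - ∑ x, p x * entropy (Φ (ρ x)) ≤ holevo Φ := by
  refine le_csSup ⟨Fintype.card κ / Real.log 2, ?_⟩ ?_
  · rintro _ ⟨m, p, ρ, hp, hp₁, hρ, rfl⟩
    have h1 := (isDensity_mixture hp hp₁ fun x => hΦ _ (hρ x)).entropy_le
    have h2 : 0 ≤ ∑ x, p x * entropy (Φ (ρ x)) :=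
      Finset.sum_nonneg fun x _ => mul_nonneg (hp x) (hΦ _ (hρ x)).entropy_nonneg
    linarith
  · let e := (Fintype.equivFin N).symm
    refine ⟨_, p ∘ e, ρ ∘ e, fun x => hp _, ?_, fun x => hρ _, ?_⟩
    · rw [← hp₁]; exact e.sum_comp p
    · simp only [Function.comp_apply]
      rw [e.sum_comp fun x => (p x : ℂ) • Φ (ρ x), e.sum_comp fun x => p x * entropy (Φ (ρ x))]

theorem sum_prod_mul_apply {N : Type*} [Fintype N] {n : ℕ} {w : N → ℝ} (hw : ∑ b, w b = 1)
    (s : N → ℝ) (k : Fin n) :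
    ∑ x : Fin n → N, (∏ j, w (x j)) * s (x k) = ∑ b, w b * s b := by
  -- Putting `s` into the `k`-th factor alone makes the sum a product over coordinates; all factors
  -- but the `k`-th are one.
  have h : ∀ x : Fin n → N, (∏ j, w (x j)) * s (x k)
      = ∏ j, w (x j) * (if j = k then s (x j) else 1) := fun x => by
    rw [Finset.prod_mul_distrib, Finset.prod_ite_eq' Finset.univ k fun j => s (x j)]
    simp
  simp only [h]
  rw [← Fintype.piFinset_univ,
    ← Finset.prod_univ_sum _ fun j b => w b * (if j = k then s b else 1),
    ← Finset.mul_prod_erase _ _ (Finset.mem_univ k)]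
  rw [Finset.prod_eq_one]
  · simp
  · intro j hj
    simp [Finset.ne_of_mem_erase hj, hw]

/-- The Holevo quantity of `n` uses is at least `n` times the value of any ensemble. -/
theorem mul_le_holevo_tensorPower {Φ : Matrix ι ι ℂ →ₗ[ℂ] Matrix κ κ ℂ} (hΦ : IsChannel Φ)
    {N : Type*} [Fintype N] {p : N → ℝ} (hp : ∀ x, 0 ≤ p x) (hp₁ : ∑ x, p x = 1)
    {ρ : N → Matrix ι ι ℂ} (hρ : ∀ x, IsDensity (ρ x)) (n : ℕ) :
    n * (entropy (∑ x, (p x : ℂ) • Φ (ρ x)) - ∑ x, p x * entropy (Φ (ρ x))) ≤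
      holevo (tensorPower Φ n) := by
  have hp₁' : ∑ x : Fin n → N, ∏ k, p (x k) = 1 := by
    rw [← Fintype.piFinset_univ, ← Finset.prod_univ_sum _ fun _ b => p b]
    simp [hp₁]
  refine le_of_eq_of_le ?_ (le_holevo (fun ρ => hΦ.tensorPower_isDensity n)
    (N := Fin n → N) (p := fun x => ∏ k, p (x k)) (fun x => Finset.prod_nonneg fun k _ => hp _)
    hp₁' (ρ := fun x => piTensor fun k => ρ (x k)) fun x => piTensor_isDensity fun k => hρ _)
  have hmix : ∑ x : Fin n → N, ((∏ k, p (x k) : ℝ) : ℂ) •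
      tensorPower Φ n (piTensor fun k => ρ (x k))
      = piTensor fun _ : Fin n => ∑ b, (p b : ℂ) • Φ (ρ b) := by
    rw [← sum_piTensor fun (_ : Fin n) b => (p b : ℂ) • Φ (ρ b)]
    refine Finset.sum_congr rfl fun x _ => ?_
    rw [tensorPower_piTensor]
    ext u v
    simp [piTensor, Finset.prod_mul_distrib]
  have havg := isDensity_mixture hp hp₁ fun x => hΦ.map_isDensity (hρ x)
  rw [hmix]
  simp only [entropy_piTensor fun _ => havg, tensorPower_piTensor,
    entropy_piTensor fun _ => hΦ.map_isDensity (hρ _), Finset.mul_sum]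
  rw [Finset.sum_comm]
  simp only [sum_prod_mul_apply hp₁ fun b => entropy (Φ (ρ b)), Finset.sum_const,
    Finset.card_univ, Fintype.card_fin, nsmul_eq_mul]
  rw [mul_sub, Finset.mul_sum]

/-- The Holevo value `g` of the equiprobable pair `ρ`, `σ` is at most the limit, zero. The midpoint
gap then bounds the squared Hilbert–Schmidt norm of `Φ ρ - Φ σ` by zero. -/
theorem HasClassicalCapacity.map_eq {Φ : Matrix ι ι ℂ →ₗ[ℂ] Matrix κ κ ℂ} (hΦ : IsChannel Φ)
    (hC : HasClassicalCapacity Φ 0) {ρ σ : Matrix ι ι ℂ} (hρ : IsDensity ρ)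
    (hσ : IsDensity σ) : Φ ρ = Φ σ := by
  let r : Bool → Matrix ι ι ℂ := fun b => if b then ρ else σ
  have hr : ∀ b, IsDensity (r b) := by simp [r, hρ, hσ]
  have hn := mul_le_holevo_tensorPower hΦ (N := Bool) (p := fun _ => 1 / 2) (by norm_num)
    (by norm_num) hr
  set g := entropy (∑ x, (((1 / 2 : ℝ)) : ℂ) • Φ (r x)) - ∑ x, 1 / 2 * entropy (Φ (r x)) with hg
  have hg0 : g ≤ 0 := by
    refine ge_of_tendsto hC ?_
    filter_upwards [eventually_gt_atTop 0] with n hn0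
    rw [le_div_iff₀ (by exact_mod_cast hn0), mul_comm]
    exact hn n
  have hA := hΦ.map_isDensity hρ
  have hB := hΦ.map_isDensity hσ
  have hgap := entropy_midpoint_gap hA hB
  have hge : g = entropy ((1 / 2 : ℂ) • Φ ρ + (1 / 2 : ℂ) • Φ σ)
      - (entropy (Φ ρ) + entropy (Φ σ)) / 2 := by
    simp only [hg, Fintype.sum_bool, r, if_true, Bool.false_eq_true, if_false]
    push_cast
    ring
  rw [← hge] at hgap
  have hD : ((Φ ρ - Φ σ) * (Φ ρ - Φ σ)).trace.re ≤ 0 := by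
    by_contra! hpos
    have : 0 < 8 * Real.log 2 := mul_pos (by norm_num) (Real.log_pos one_lt_two)
    linarith [div_pos hpos this]
  have hH : (Φ ρ - Φ σ)ᴴ = Φ ρ - Φ σ := (hA.1.1.sub hB.1.1).eq
  have htr : ((Φ ρ - Φ σ)ᴴ * (Φ ρ - Φ σ)).trace = 0 := by
    have h0 := (posSemidef_conjTranspose_mul_self (Φ ρ - Φ σ)).trace_nonneg
    refine le_antisymm (Complex.le_def.mpr ⟨?_, ?_⟩) h0
    · simpa [hH] using hD
    · exact (Complex.le_def.mp h0).2.symm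
  exact sub_eq_zero.mp (trace_conjTranspose_mul_self_eq_zero_iff.mp htr)

theorem HasClassicalCapacity.isCompleteErasure [Nonempty ι]
    {Φ : Matrix ι ι ℂ →ₗ[ℂ] Matrix κ κ ℂ} (hΦ : IsChannel Φ)
    (hC : HasClassicalCapacity Φ 0) : IsCompleteErasure Φ := by
  obtain ⟨i⟩ := ‹Nonempty ι›
  have hi : IsDensity (single i i (1 : ℂ)) := isDensity_single i
  exact ⟨hΦ, _, hΦ.map_isDensity hi, fun ρ hρ => hC.map_eq hΦ hρ hi⟩

open scoped MatrixOrder Matrix.Norms.L2Operator in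
-- Positive matrices span, and a nonzero one is a multiple of a density.
theorem eq_trace_smul_of_isDensity {Φ : Matrix ι ι ℂ →ₗ[ℂ] Matrix κ κ ℂ} {e : Matrix κ κ ℂ}
    (h : ∀ ρ, IsDensity ρ → Φ ρ = e) (X : Matrix ι ι ℂ) : Φ X = X.trace • e := by
  have hX : X ∈ Submodule.span ℂ {a : Matrix ι ι ℂ | 0 ≤ a} := by
    rw [CStarAlgebra.span_nonneg]; trivial
  induction hX using Submodule.span_induction with
  | mem Y hY =>
    have hY' : Y.PosSemidef := nonneg_iff_posSemidef.mp hY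
    by_cases h0 : Y.trace = 0
    · rw [h0, hY'.trace_eq_zero_iff.mp h0, map_zero, zero_smul]
    · have := h (Y.trace⁻¹ • Y) ⟨hY'.smul (inv_nonneg.mpr hY'.trace_nonneg), by
        rw [trace_smul, smul_eq_mul, inv_mul_cancel₀ h0]⟩
      rw [← this, map_smul, smul_smul, mul_inv_cancel₀ h0, one_smul]
  | zero => simp
  | add Y Z _ _ hY hZ => rw [map_add, hY, hZ, trace_add, add_smul]
  | smul c Y _ hY => rw [map_smul, hY, trace_smul, smul_smul, smul_eq_mul]

end Capacity

/-! ### Phase decompositions, and Kraus identities for the blocks of the switch. -/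

section Switch

open Matrix

variable {ι : Type*} [Fintype ι] [DecidableEq ι]

/-- `G` is the average of unit complex numbers under a POVM. -/
def HasPhaseDecomposition (G : Matrix ι ι ℂ) : Prop :=
  ∃ (N : ℕ) (M : Fin N → Matrix ι ι ℂ) (z : Fin N → ℂ), (∀ k, (M k).PosSemidef) ∧
    ∑ k, M k = 1 ∧ (∀ k, z k * star (z k) = 1) ∧ G = ∑ k, z k • M k

theorem HasPhaseDecomposition.of_fintype {N : Type*} [Fintype N] {G : Matrix ι ι ℂ}
    (M : N → Matrix ι ι ℂ) (z : N → ℂ) (hM : ∀ k, (M k).PosSemidef) (hM₁ : ∑ k, M k = 1)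
    (hz : ∀ k, z k * star (z k) = 1) (hG : G = ∑ k, z k • M k) : HasPhaseDecomposition G := by
  let e := (Fintype.equivFin N).symm
  refine ⟨_, M ∘ e, z ∘ e, fun k => hM _, ?_, fun k => hz _, ?_⟩
  · rw [← hM₁]; exact e.sum_comp M
  · rw [hG]; exact (e.sum_comp fun k => z k • M k).symm

open scoped Matrix.Norms.L2Operator in
/-- The spectral decomposition of a unitary matrix. -/
theorem hasPhaseDecomposition_of_unitary {U : Matrix ι ι ℂ} (hU : U ∈ unitaryGroup ι ℂ) :
    HasPhaseDecomposition U := by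
  have hfin : (spectrum ℂ U).Finite := U.finite_spectrum
  have hN : IsStarNormal U := ⟨by
    rw [Commute, SemiconjBy, (mem_unitaryGroup_iff'.mp hU), mem_unitaryGroup_iff.mp hU]⟩
  have hc : ∀ f : ℂ → ℂ, ContinuousOn f (spectrum ℂ U) := fun f => hfin.continuousOn f
  -- `cfc (δ z) U` is the spectral projection at `z`; finiteness of the spectrum makes every
  -- function continuous on it.
  let δ : ℂ → ℂ → ℂ := fun z w => if w = z then 1 else 0
  let S := hfin.toFinset
  have hsum : ∀ g : ℂ → ℂ, ∑ z : S, g z • cfc (δ z) U = cfc g U := by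
    intro g
    rw [Finset.sum_coe_sort S fun z => g z • cfc (δ z) U]
    simp only [← cfc_smul _ _ U (hc _)]
    rw [← cfc_sum _ _ _ fun i _ => hc _]
    refine cfc_congr fun w hw => ?_
    have hwS : w ∈ S := hfin.mem_toFinset.mpr hw
    simp [δ, Finset.sum_apply, hwS]
  refine .of_fintype (fun z : S => cfc (δ z) U) (fun z => z) (fun z => ?_) ?_ (fun z => ?_) ?_
  · have h : cfc (δ z) U = (cfc (δ z) U)ᴴ * cfc (δ z) U := by
      rw [← star_eq_conjTranspose, ← cfc_star, ← cfc_mul _ _ U (hc _) (hc _)]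
      refine cfc_congr fun w _ => ?_
      simp [δ]
    rw [h]
    exact posSemidef_conjTranspose_mul_self _
  · have := hsum fun _ => 1
    simp only [one_smul] at this
    rw [this, cfc_const_one ℂ U]
  · have hz : (z : ℂ) ∈ spectrum ℂ U := hfin.mem_toFinset.mp z.2
    have := spectrum.subset_circle_of_unitary (𝕜 := ℂ) hU hz
    rw [RCLike.star_def, Complex.mul_conj, Complex.normSq_eq_norm_sq]
    simp only [mem_sphere_iff_norm, sub_zero] at this
    simp [this]
  · exact ((hsum fun w => w).trans (cfc_id' ℂ U)).symm

theorem HasPhaseDecomposition.midpoint {A B : Matrix ι ι ℂ} (hA : HasPhaseDecomposition A)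
    (hB : HasPhaseDecomposition B) :
    HasPhaseDecomposition ((1 / 2 : ℂ) • A + (1 / 2 : ℂ) • B) := by
  obtain ⟨N, M, z, hM, hM₁, hz, rfl⟩ := hA
  obtain ⟨N', M', z', hM', hM₁', hz', rfl⟩ := hB
  have h2 : (0 : ℂ) ≤ 1 / 2 := by
    rw [show (1 / 2 : ℂ) = ((1 / 2 : ℝ) : ℂ) by push_cast; rfl]
    exact_mod_cast (by norm_num : (0 : ℝ) ≤ 1 / 2)
  refine .of_fintype (N := Fin N ⊕ Fin N')
    (Sum.elim (fun k => (1 / 2 : ℂ) • M k) fun k => (1 / 2 : ℂ) • M' k) (Sum.elim z z')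
    ?_ ?_ ?_ ?_
  · rintro (k | k)
    · exact (hM k).smul h2
    · exact (hM' k).smul h2
  · simp only [Fintype.sum_sum_type, Sum.elim_inl, Sum.elim_inr, ← Finset.smul_sum, hM₁, hM₁']
    rw [← add_smul]; norm_num
  · rintro (k | k)
    · exact hz k
    · exact hz' k
  · simp only [Fintype.sum_sum_type, Sum.elim_inl, Sum.elim_inr, Finset.smul_sum]
    congr 1 <;> exact Finset.sum_congr rfl fun k _ => smul_comm _ _ _

/-- The rank-one operator between two columns of unitary matrices is an average of phases. -/
theorem hasPhaseDecomposition_single {U V : Matrix ι ι ℂ} (hU : Uᴴ * U = 1) (hV : Vᴴ * V = 1)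
    (m n : ι) : HasPhaseDecomposition (V * single n m 1 * Uᴴ) := by
  -- `P` sends the `m`-th basis vector to the `n`-th, and `D` flips the sign of every other basis
  -- vector. So `P` and `P * D` agree on the `m`-th vector and cancel on the rest: their average is
  -- the matrix unit.
  let P : Matrix ι ι ℂ := of fun i j => if i = Equiv.swap m n j then 1 else 0
  let D : Matrix ι ι ℂ := diagonal fun i => if i = m then 1 else -1
  have hP : Pᴴ * P = 1 := by
    ext i j
    simp only [mul_apply, conjTranspose_apply, P, of_apply, one_apply]
    by_cases h : i = j
    · simp [h]
    · simp [h]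
      simpa using fun hh => h hh.symm
  have hD : Dᴴ * D = 1 := by
    simp only [D, diagonal_conjTranspose, diagonal_mul_diagonal, Pi.star_apply]
    rw [← diagonal_one]
    congr 1
    ext i
    split_ifs <;> simp
  have hU' : U ∈ unitaryGroup ι ℂ := mem_unitaryGroup_iff'.mpr hU
  have hV' : V ∈ unitaryGroup ι ℂ := mem_unitaryGroup_iff'.mpr hV
  have hP' : P ∈ unitaryGroup ι ℂ := mem_unitaryGroup_iff'.mpr hP
  have hD' : D ∈ unitaryGroup ι ℂ := mem_unitaryGroup_iff'.mpr hD
  have hUs : Uᴴ ∈ unitaryGroup ι ℂ := Unitary.star_mem hU'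
  have key : single n m (1 : ℂ) = (1 / 2 : ℂ) • P + (1 / 2 : ℂ) • (P * D) := by
    ext i j
    simp only [D, Matrix.add_apply, Matrix.smul_apply, mul_diagonal, P, of_apply, single_apply,
      smul_eq_mul]
    by_cases hj : j = m
    · subst hj
      by_cases hi : i = n
      · simp [hi]; norm_num
      · simp [hi, Ne.symm hi]
    · simp [hj, Ne.symm hj]
  have : V * single n m 1 * Uᴴ = (1 / 2 : ℂ) • (V * P * Uᴴ) + (1 / 2 : ℂ) • (V * (P * D) * Uᴴ) := by
    rw [key, mul_add, add_mul, Matrix.mul_smul, Matrix.mul_smul, Matrix.smul_mul, Matrix.smul_mul]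
  rw [this]
  exact (hasPhaseDecomposition_of_unitary (mul_mem (mul_mem hV' hP') hUs)).midpoint
    (hasPhaseDecomposition_of_unitary (mul_mem (mul_mem hV' (mul_mem hP' hD')) hUs))

/-- Erasure of matrix units fixes every `∑ j, L j a p * star (L j c q)` as `f a c` if `p = q` and
zero otherwise; contract this with `X`. -/
theorem sum_trace_smul_conjTranspose {μ : Type*} [Fintype μ] {F : Matrix ι ι ℂ →ₗ[ℂ] Matrix ι ι ℂ}
    {L : μ → Matrix ι ι ℂ} (hL : IsKraus F L) {f : Matrix ι ι ℂ}
    (hF : ∀ X, F X = X.trace • f) (X : Matrix ι ι ℂ) :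
    ∑ j, (L j * X).trace • (L j)ᴴ = X * f := by
  have hs : ∀ p q a c, ∑ j, L j a p * star (L j c q) = if p = q then f a c else 0 := by
    intro p q a c
    have h := congrFun (congrFun ((hL (single p q 1)).symm.trans (hF (single p q 1))) a) c
    simp only [Matrix.sum_apply, mul_apply, single_apply, ite_and, mul_ite, mul_one, mul_zero,
      conjTranspose_apply, Matrix.smul_apply, smul_eq_mul] at h
    simp only [ite_mul, zero_mul, Finset.sum_ite_eq, Finset.mem_univ, if_true] at h
    rw [h]
    by_cases hpq : p = q
    · simp [hpq]
    · simp [hpq, trace_single_eq_of_ne]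
  ext q c
  simp only [Matrix.sum_apply, Matrix.smul_apply, trace, diag_apply, mul_apply, smul_eq_mul,
    conjTranspose_apply, Finset.sum_mul]
  rw [Finset.sum_comm]
  refine Finset.sum_congr rfl fun a _ => ?_
  rw [Finset.sum_comm]
  calc ∑ p, ∑ j, L j a p * X p a * star (L j c q)
      = ∑ p, X p a * ∑ j, L j a p * star (L j c q) := by
        simp only [Finset.mul_sum]
        exact Finset.sum_congr rfl fun p _ => Finset.sum_congr rfl fun j _ => by ring
    _ = X q a * f a c := by
        simp only [hs, mul_ite, mul_zero, Finset.sum_ite_eq', Finset.mem_univ, if_true]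

/-- The interference of the two orders. Summing over `i` applies `E` to `L j * X`, leaving `tr (L j
* X) • e * (L j)ᴴ`; the sum over `j` then returns `X * f`. -/
theorem sum_sum_kraus_interchange {ν μ : Type*} [Fintype ν] [Fintype μ]
    {E F : Matrix ι ι ℂ →ₗ[ℂ] Matrix ι ι ℂ} {K : ν → Matrix ι ι ℂ} {L : μ → Matrix ι ι ℂ}
    (hK : IsKraus E K) (hL : IsKraus F L) {e f : Matrix ι ι ℂ}
    (hE : ∀ X, E X = X.trace • e) (hF : ∀ X, F X = X.trace • f) (X : Matrix ι ι ℂ) :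
    ∑ i, ∑ j, (K i * L j) * X * (L j * K i)ᴴ = e * X * f := by
  rw [Finset.sum_comm]
  calc ∑ j, ∑ i, (K i * L j) * X * (L j * K i)ᴴ
      = ∑ j, E (L j * X) * (L j)ᴴ := by
        refine Finset.sum_congr rfl fun j _ => ?_
        rw [hK, Finset.sum_mul]
        refine Finset.sum_congr rfl fun i _ => ?_
        simp only [conjTranspose_mul, mul_assoc]
    _ = e * ∑ j, (L j * X).trace • (L j)ᴴ := by
        rw [Finset.mul_sum]
        refine Finset.sum_congr rfl fun j _ => ?_
        rw [hE, Matrix.smul_mul, Matrix.mul_smul]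
    _ = _ := by rw [sum_trace_smul_conjTranspose hL hF, mul_assoc]

theorem sum_sum_kraus_comp {ν μ : Type*} [Fintype ν] [Fintype μ]
    {E F : Matrix ι ι ℂ →ₗ[ℂ] Matrix ι ι ℂ} {K : ν → Matrix ι ι ℂ} {L : μ → Matrix ι ι ℂ}
    (hK : IsKraus E K) (hL : IsKraus F L) (X : Matrix ι ι ℂ) :
    ∑ i, ∑ j, (K i * L j) * X * (K i * L j)ᴴ = E (F X) := by
  rw [hK, hL]
  refine Finset.sum_congr rfl fun i _ => ?_
  rw [Finset.mul_sum, Finset.sum_mul]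
  refine Finset.sum_congr rfl fun j _ => ?_
  simp only [conjTranspose_mul, mul_assoc]

/-- The blocks of the output of the switched channel. -/
theorem switchedChannel_apply {ν μ : Type*} [Fintype ν] [Fintype μ]
    (K : ν → Matrix ι ι ℂ) (L : μ → Matrix ι ι ℂ) (ω : Matrix (Fin 2) (Fin 2) ℂ)
    (X : Matrix ι ι ℂ) (x y : ι) (s t : Fin 2) :
    switchedChannel K L ω X (x, s) (y, t)
      = ω s t * (∑ i, ∑ j, (if s = 0 then K i * L j else L j * K i) * X *
          (if t = 0 then K i * L j else L j * K i)ᴴ) x y := by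
  simp only [switchedChannel, LinearMap.coe_mk, AddHom.coe_mk, Matrix.sum_apply, Finset.mul_sum]
  refine Finset.sum_congr rfl fun i _ => Finset.sum_congr rfl fun j _ => ?_
  have hk : ∀ (x y : ι) (s t : Fin 2), switchKraus K L i j (x, s) (y, t)
      = if s = t then (if s = 0 then K i * L j else L j * K i) x y else 0 := by
    intro x y s t
    fin_cases s <;> fin_cases t <;> simp [switchKraus]
  simp only [mul_apply (M := _ * _ ⊗ₖ _), mul_apply (M := switchKraus K L i j),
    mul_apply (N := (ite _ _ _)ᴴ), mul_apply (N := X), conjTranspose_apply,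
    Fintype.sum_prod_type, hk, kroneckerMap_apply]
  simp only [ite_mul, zero_mul, Finset.sum_ite_eq, Finset.mem_univ, if_true, apply_ite star,
    star_zero, mul_ite, mul_zero, Finset.mul_sum, Finset.sum_mul]
  refine Finset.sum_congr rfl fun a _ => Finset.sum_congr rfl fun b _ => ?_
  ring

end Switch

/-! ### The switch of two complete erasures measures and prepares. -/

section SwitchErasure

open Matrix

variable {ι : Type*} [Fintype ι] [DecidableEq ι]

/-- The isometry embedding the control qubit with branch vectors `u` and `v`. -/
def branchIsometry (u v : ι → ℂ) : Matrix (ι × Fin 2) (Fin 2) ℂ :=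
  of fun p t => if p.2 = t then (if t = 0 then u p.1 else v p.1) else 0

omit [DecidableEq ι] in
theorem branchIsometry_isDensity {u v : ι → ℂ} (hu : ∑ x, star (u x) * u x = 1)
    (hv : ∑ x, star (v x) * v x = 1) {ω : Matrix (Fin 2) (Fin 2) ℂ} (hω : IsDensity ω) :
    IsDensity (branchIsometry u v * ω * (branchIsometry u v)ᴴ) := by
  have h : (branchIsometry u v)ᴴ * branchIsometry u v = 1 := by
    ext s t
    fin_cases s <;> fin_cases t <;>
      simp [branchIsometry, mul_apply, Fintype.sum_prod_type]
    · simpa using hu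
    · simpa using hv
  refine ⟨hω.1.mul_mul_conjTranspose_same _, ?_⟩
  rw [trace_mul_comm, ← Matrix.mul_assoc, h, Matrix.one_mul, hω.2]

omit [Fintype ι] [DecidableEq ι] in
theorem branchIsometry_conj_apply (u v : ι → ℂ) (ω : Matrix (Fin 2) (Fin 2) ℂ) (x y : ι)
    (s t : Fin 2) :
    (branchIsometry u v * ω * (branchIsometry u v)ᴴ) (x, s) (y, t)
      = (if s = 0 then u x else v x) * ω s t * star (if t = 0 then u y else v y) := by
  fin_cases s <;> fin_cases t <;> simp [branchIsometry, mul_apply]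

theorem trace_conj_single_mul (U V X : Matrix ι ι ℂ) (m n : ι) :
    (V * single n m 1 * Uᴴ * X).trace = (Uᴴ * X * V) m n := by
  rw [Matrix.mul_assoc, Matrix.mul_assoc, trace_mul_comm, Matrix.mul_assoc, trace_single_mul]
  simp

theorem conj_diagonal_apply (U V Y : Matrix ι ι ℂ) (a b : ι → ℂ) (x y : ι) :
    (U * diagonal a * Y * (diagonal b * Vᴴ)) x y
      = ∑ p : ι × ι, a p.1 * b p.2 * (U x p.1 * Y p.1 p.2 * star (V y p.2)) := by
  simp only [mul_apply (M := _ * Y), mul_apply (N := Y), mul_diagonal, diagonal_mul,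
    conjTranspose_apply, Fintype.sum_prod_type, Finset.sum_mul]
  rw [Finset.sum_comm]
  exact Finset.sum_congr rfl fun m _ => Finset.sum_congr rfl fun n _ => by ring

/-- The switch of two complete erasure channels measures a POVM and prepares a state. -/
theorem isMeasurePrepare_switchedChannel {ν μ : Type*} [Fintype ν] [Fintype μ]
    {E F : Matrix ι ι ℂ →ₗ[ℂ] Matrix ι ι ℂ} {K : ν → Matrix ι ι ℂ} {L : μ → Matrix ι ι ℂ}
    (hK : IsKraus E K) (hL : IsKraus F L) (hE : IsCompleteErasure E) (hF : IsCompleteErasure F)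
    {ω : Matrix (Fin 2) (Fin 2) ℂ} (hω : IsDensity ω) :
    IsMeasurePrepare (switchedChannel K L ω) := by
  obtain ⟨⟨-, hEtr⟩, e, he, hEe⟩ := hE
  obtain ⟨⟨-, hFtr⟩, f, hf, hFf⟩ := hF
  replace hEe := eq_trace_smul_of_isDensity hEe
  replace hFf := eq_trace_smul_of_isDensity hFf
  obtain ⟨U, hU₁, hU₂, hUe⟩ := exists_diagonalization he.1.1
  obtain ⟨V, hV₁, hV₂, hVf⟩ := exists_diagonalization hf.1.1
  have ha₀ := he.1.eigenvalues_nonneg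
  have hb₀ := hf.1.eigenvalues_nonneg
  have ha₁ := IsDensity.sum_eigenvalues he
  have hb₁ := IsDensity.sum_eigenvalues hf
  set a := he.1.1.eigenvalues
  set b := hf.1.1.eigenvalues
  have ha₁' : ∑ i, (a i : ℂ) = 1 := by exact_mod_cast ha₁
  have hb₁' : ∑ i, (b i : ℂ) = 1 := by exact_mod_cast hb₁
  have hab : ∑ p : ι × ι, (a p.1 : ℂ) * b p.2 = 1 := by
    rw [Fintype.sum_prod_type]
    simp only
    rw [← Finset.sum_mul_sum, ha₁', hb₁', mul_one]
  choose N M z hM hM₁ hz hG using fun p : ι × ι => hasPhaseDecomposition_single hU₁ hV₁ p.1 p.2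
  have hUcol : ∀ m, ∑ x, star (U x m) * U x m = 1 := fun m => by
    simpa [mul_apply] using congrFun (congrFun hU₁ m) m
  have hVcol : ∀ n, ∑ x, star (V x n) * V x n = 1 := fun n => by
    simpa [mul_apply] using congrFun (congrFun hV₁ n) n
  have htr : ∀ (X : Matrix ι ι ℂ) p, ∑ k, (M p k * X).trace = X.trace := fun X p => by
    rw [← trace_sum, ← Matrix.sum_mul, hM₁, Matrix.one_mul]
  -- The coherence `⟨u_m|X|v_n⟩` is a phase average over the same outcome weights that sum to
  -- `X.trace`.
  have hphase : ∀ (X : Matrix ι ι ℂ) p, ∑ k, (M p k * X).trace * z p k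
      = (Uᴴ * X * V) p.1 p.2 := fun X p => by
    rw [← trace_conj_single_mul, hG p, Matrix.sum_mul, trace_sum]
    simp [mul_comm]
  have hphase' : ∀ (X : Matrix ι ι ℂ) p, ∑ k, (M p k * X).trace * star (z p k)
      = (Vᴴ * X * U) p.2 p.1 := fun X p => by
    have h := congrArg conjTranspose (hG p)
    simp only [conjTranspose_mul, conjTranspose_conjTranspose, conjTranspose_single, star_one,
      conjTranspose_sum, conjTranspose_smul, (hM p _).1.eq] at h
    rw [← Matrix.mul_assoc] at h
    rw [← trace_conj_single_mul, h, Matrix.sum_mul, trace_sum]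
    simp [mul_comm]
  -- An outcome is an eigenvector pair with a phase. The phase is conjugated on the second branch
  -- because the (0, 1) block conjugates that branch again.
  refine .of_fintype (N := Σ p : ι × ι, Fin (N p))
    (fun q => ((a q.1.1 : ℂ) * b q.1.2) • M q.1 q.2)
    (fun q => branchIsometry (fun x => U x q.1.1) (fun x => star (z q.1 q.2) * V x q.1.2) * ω *
      (branchIsometry (fun x => U x q.1.1) (fun x => star (z q.1 q.2) * V x q.1.2))ᴴ)
    (fun q => (hM _ _).smul ?_) ?_ (fun q => branchIsometry_isDensity (hUcol _) ?_ hω)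
    fun X => ?_
  · exact mul_nonneg (by exact_mod_cast ha₀ _) (by exact_mod_cast hb₀ _)
  · rw [Fintype.sum_sigma]
    simp only [← Finset.smul_sum, hM₁]
    rw [← Finset.sum_smul, hab, one_smul]
  · rw [← hVcol q.1.2]
    refine Finset.sum_congr rfl fun x _ => ?_
    rw [star_mul', star_star]
    linear_combination (star (V x q.1.2) * V x q.1.2) * hz q.1 q.2
  · have hdiag : ∀ (W : Matrix ι ι ℂ) (c : ι → ℝ) (x y : ι),
        (W * diagonal (fun i => (c i : ℂ)) * Wᴴ) x y = ∑ m, c m * (W x m * star (W y m)) := by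
      intro W c x y
      simp only [mul_apply (N := Wᴴ), mul_diagonal, conjTranspose_apply]
      exact Finset.sum_congr rfl fun m _ => by ring
    ext ⟨x, s⟩ ⟨y, t⟩
    simp only [Matrix.sum_apply, Fintype.sum_sigma, Matrix.smul_apply, smul_eq_mul,
      branchIsometry_conj_apply, Matrix.smul_mul, trace_smul]
    rw [switchedChannel_apply]
    match s, t with
    | 0, 0 =>
      simp only [if_true]
      rw [sum_sum_kraus_comp hK hL, hEe, hFtr, Matrix.smul_apply, smul_eq_mul]
      conv_lhs => rw [hUe, hdiag]
      -- This block ignores `f`; its index is inserted through `∑ b = 1`.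
      calc _ = ω 0 0 * X.trace * ∑ m, ((a m : ℂ) * (U x m * star (U y m)) * ∑ n, (b n : ℂ)) := by
            rw [hb₁']; simp only [mul_one, mul_assoc]
        _ = ∑ p : ι × ι, ω 0 0 * X.trace * (a p.1 * (U x p.1 * star (U y p.1)) * b p.2) := by
            simp only [Fintype.sum_prod_type, Finset.mul_sum]
        _ = _ := by
            refine Finset.sum_congr rfl fun p _ => ?_
            rw [← Finset.sum_mul, ← Finset.mul_sum, htr]
            ring
    | 1, 1 =>
      simp only [one_ne_zero, if_false]
      rw [Finset.sum_comm, sum_sum_kraus_comp hL hK, hFf, hEtr, Matrix.smul_apply, smul_eq_mul]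
      conv_lhs => rw [hVf, hdiag]
      calc _ = ω 1 1 * X.trace * ((∑ m, (a m : ℂ)) * ∑ n, (b n : ℂ) * (V x n * star (V y n))) := by
            rw [ha₁', one_mul, mul_assoc]
        _ = ∑ p : ι × ι, ω 1 1 * X.trace * (a p.1 * (b p.2 * (V x p.2 * star (V y p.2)))) := by
            rw [Finset.sum_mul_sum, Fintype.sum_prod_type]
            simp only [Finset.mul_sum]
        _ = _ := by
            refine Finset.sum_congr rfl fun p _ => ?_
            rw [← htr X p, Finset.mul_sum, Finset.sum_mul]
            refine Finset.sum_congr rfl fun k _ => ?_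
            rw [star_mul', star_star]
            -- In the second diagonal block the phase meets its conjugate and drops out.
            linear_combination (-(ω 1 1 * (M p k * X).trace * (a p.1 * (b p.2 *
              (V x p.2 * star (V y p.2)))))) * hz p k
    | 0, 1 =>
      simp only [if_true, one_ne_zero, if_false]
      rw [sum_sum_kraus_interchange hK hL hEe hFf]
      have h : e * X * f = U * diagonal (fun i => (a i : ℂ)) * (Uᴴ * X * V)
          * (diagonal (fun i => (b i : ℂ)) * Vᴴ) := by
        conv_lhs => rw [hUe, hVf]
        simp only [Matrix.mul_assoc]
      rw [h, conj_diagonal_apply, Finset.mul_sum]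
      refine Finset.sum_congr rfl fun p _ => ?_
      rw [← hphase, Finset.mul_sum, Finset.sum_mul, Finset.mul_sum, Finset.mul_sum]
      refine Finset.sum_congr rfl fun k _ => ?_
      rw [star_mul', star_star]
      ring
    | 1, 0 =>
      simp only [if_true, one_ne_zero, if_false]
      rw [Finset.sum_comm, sum_sum_kraus_interchange hL hK hFf hEe]
      have h : f * X * e = V * diagonal (fun i => (b i : ℂ)) * (Vᴴ * X * U)
          * (diagonal (fun i => (a i : ℂ)) * Uᴴ) := by
        conv_lhs => rw [hUe, hVf]
        simp only [Matrix.mul_assoc]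
      rw [h, conj_diagonal_apply, Finset.mul_sum, ← (Equiv.prodComm ι ι).sum_comp]
      refine Finset.sum_congr rfl fun p _ => ?_
      simp only [Equiv.prodComm_apply, Prod.fst_swap, Prod.snd_swap]
      rw [← hphase', Finset.mul_sum, Finset.sum_mul, Finset.mul_sum, Finset.mul_sum]
      exact Finset.sum_congr rfl fun k _ => by ring

end SwitchErasure

end QSwitch

/-- Let `E`, `F` be quantum channels on a finite-dimensional system with any Kraus families
`K`, `L`, and let `ω` be any state of the control qubit. If `E` and `F` are complete erasure
channels, then the switched channel is entanglement-breaking. If `E` and `F` have zero classical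
capacity, then the switched channel has zero quantum capacity. -/
theorem theorem3 {ι ν μ : Type*} [Fintype ι] [DecidableEq ι] [Nonempty ι]
    [Fintype ν] [Fintype μ]
    (E F : Matrix ι ι ℂ →ₗ[ℂ] Matrix ι ι ℂ)
    (hE : QSwitch.IsChannel E) (hF : QSwitch.IsChannel F)
    (K : ν → Matrix ι ι ℂ) (L : μ → Matrix ι ι ℂ)
    (hK : QSwitch.IsKraus E K) (hL : QSwitch.IsKraus F L)
    (ω : Matrix (Fin 2) (Fin 2) ℂ) (hω : QSwitch.IsDensity ω) :
    (QSwitch.IsCompleteErasure E → QSwitch.IsCompleteErasure F →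
      QSwitch.IsEntanglementBreaking (QSwitch.switchedChannel K L ω)) ∧
    (QSwitch.HasClassicalCapacity E 0 → QSwitch.HasClassicalCapacity F 0 →
      QSwitch.HasQuantumCapacity (QSwitch.switchedChannel K L ω) 0) :=
  ⟨fun h₁ h₂ => (QSwitch.isMeasurePrepare_switchedChannel hK hL h₁ h₂ hω).isEntanglementBreaking,
    fun h₁ h₂ => (QSwitch.isMeasurePrepare_switchedChannel hK hL (h₁.isCompleteErasure hE)
      (h₂.isCompleteErasure hF) hω).hasQuantumCapacity_zero⟩
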